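/- Let $[a,b]$ denote the determinant of the $2\times2$ matrix with columns $a,b\in\mathbb{R}^2$. Let $U\subset\mathbb{R}^2$ be the (closed, centrally symmetric) unit ball of a norm on $\mathbb{R}^2$, with area $A_U$. Assume that $\partial U$ has a closed counterclockwise parameterization $u:[0,2T]\to\partial U$, $T>0$, injective on $[0,2T)$, and that there are $0=t_0<t_1<\dots<t_{2n}=2T$ such that on each interval $[t_i,t_{i+1}]$ the map $u$ is $C^\infty$ with $u'\neq 0$ and $[u,u']>0$ (one-sided derivatives at the endpoints), such that each arc $u_i=u([t_i,t_{i+1}])$ is either a straight segment or a strictly convex arc with $[u',u'']\ne0$ on $[t_i,t_{i+1}]$, and $u_{i+n}=-u_i$ for $0\le i<n$. The straight arcs are whole sides of $U$: no two of them lie on a common line. A curve $\gamma:[0,2T]\to\mathbb{R}^2$ is called admissible if $\gamma(0)=\gamma(2T)$, $\gamma$ is $C^\infty$ on each $[t_i,t_{i+1}]$, and there is a scalar function $r$ (the curvature radius) with $\gamma'(t)=r(t)\,u'(t)$ for $t_i<t<t_{i+1}$, $0\le i<2n$, where $r$ is constant on each interval $(t_i,t_{i+1})$ for which $u_i$ is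 a straight segment (it is the signed ratio of the segments traced by $\gamma$ and $u$). Its dual length and signed area are $$L_*(\gamma)=\int_0^{2T} r(t)\,[u(t),u'(t)]\,dt,\qquad A_\gamma=\frac12\int_0^{2T}[\gamma(t),\gamma'(t)]\,dt .$$ Let $\gamma$ be a convex admissible curve, that is, an admissible curve which has a supporting line through each of its points. Then $$\frac{L_*(\gamma)^2}{4A_U}\ \ge\ A_\gamma ,$$ and equality holds if and only if $\gamma$ is, up to a translation, a multiple of the unit circle, i.e. there are $c\in\mathbb{R}$ and $p\in\mathbb{R}^2$ with $\gamma(t)=c\,u(t)+p$ for all $t\in[0,2T]$. -/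

import Mathlib

open MeasureTheory
open scoped ContDiff

namespace NormedPlane

/-- The bracket `[a, b]`: the determinant of the `2 × 2` matrix with columns `a`, `b`. -/
def det (a b : ℝ × ℝ) : ℝ := a.1 * b.2 - a.2 * b.1

/-- The unit ball of the norm `N` on the plane. -/
def unitBall (N : Seminorm ℝ (ℝ × ℝ)) : Set (ℝ × ℝ) := N.closedBall 0 1

/-- The arc of the curve `u` over the parameter interval `[a, b]`. -/
def arc (u : ℝ → ℝ × ℝ) (a b : ℝ) : Set (ℝ × ℝ) := u '' Set.Icc a b

/-- The arc of `u` over `[a, b]` is a straight segment. -/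
def IsStraightArc (u : ℝ → ℝ × ℝ) (a b : ℝ) : Prop :=
  arc u a b = segment ℝ (u a) (u b)

/-- The arc of `u` over `[a, b]` is strictly convex: `[u', u''] ≠ 0` (one-sided derivatives at
the two ends). -/
def IsStrictlyConvexArc (u : ℝ → ℝ × ℝ) (a b : ℝ) : Prop :=
  ∀ s ∈ Set.Icc a b,
    det (derivWithin u (Set.Icc a b) s) (iteratedDerivWithin 2 u (Set.Icc a b) s) ≠ 0

/-- The points `0 = t 0 < t 1 < ⋯ < t (2 n) = 2 T`. Only the values `t i` with `i ≤ 2 n`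
matter. -/
structure IsSubdivision (n : ℕ) (T : ℝ) (t : ℕ → ℝ) : Prop where
  pos : 0 < T
  first : t 0 = 0
  last : t (2 * n) = 2 * T
  lt : ∀ i < 2 * n, t i < t (i + 1)

/-- The curve `c` is smooth by parts with respect to the subdivision: it is smooth on each closed
interval `[t i, t (i + 1)]`. As these intervals cover `[0, 2 T]`, it is continuous there. -/
def SmoothByParts (n : ℕ) (t : ℕ → ℝ) (c : ℝ → ℝ × ℝ) : Prop :=
  ∀ i < 2 * n, ContDiffOn ℝ ∞ c (Set.Icc (t i) (t (i + 1)))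

/-- `u`, defined on `[0, 2 T]`, is a counterclockwise parameterization of the boundary of the unit
ball of `N`, smooth by parts, whose arcs `u_i` over `[t i, t (i + 1)]` satisfy `u_{i+n} = - u_i`
and are straight segments or smooth strictly convex arcs. -/
structure IsUnitCircle (N : Seminorm ℝ (ℝ × ℝ)) (n : ℕ) (T : ℝ) (t : ℕ → ℝ)
    (u : ℝ → ℝ × ℝ) : Prop where
  subdivision : IsSubdivision n T t
  smooth : SmoothByParts n t u
  closed : u 0 = u (2 * T)
  injOn : Set.InjOn u (Set.Ico 0 (2 * T))
  image_eq : u '' Set.Icc 0 (2 * T) = frontier (unitBall N)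
  symm : ∀ i < n, arc u (t (i + n)) (t (i + n + 1)) = (fun x => -x) '' arc u (t i) (t (i + 1))
  deriv_ne_zero : ∀ i < 2 * n, ∀ s ∈ Set.Icc (t i) (t (i + 1)),
    derivWithin u (Set.Icc (t i) (t (i + 1))) s ≠ 0
  counterclockwise : ∀ i < 2 * n, ∀ s ∈ Set.Icc (t i) (t (i + 1)),
    0 < det (u s) (derivWithin u (Set.Icc (t i) (t (i + 1))) s)
  arcs : ∀ i < 2 * n,
    IsStraightArc u (t i) (t (i + 1)) ∨ IsStrictlyConvexArc u (t i) (t (i + 1))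
  /-- The straight arcs are whole sides: the ends of a side are vertices, so that a side is not cut
  into several arcs. -/
  sides : ∀ i < 2 * n, ∀ j < 2 * n, i ≠ j →
    IsStraightArc u (t i) (t (i + 1)) → IsStraightArc u (t j) (t (j + 1)) →
    ¬ Collinear ℝ (arc u (t i) (t (i + 1)) ∪ arc u (t j) (t (j + 1)))

/-- `γ`, defined on `[0, 2 T]`, is an admissible curve for `u` with curvature radius `r`: a closed
curve, smooth by parts, with `γ' = r u'`. (At the points `t i` the equation holds in the limit, for
the one-sided derivatives; the value of `r` there is immaterial.) Over a side of `u`, the curve `γ`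
runs along a parallel segment, and `r` is the ratio of these two segments, a constant. -/
structure IsAdmissible (n : ℕ) (T : ℝ) (t : ℕ → ℝ) (u γ : ℝ → ℝ × ℝ) (r : ℝ → ℝ) : Prop where
  smooth : SmoothByParts n t γ
  closed : γ 0 = γ (2 * T)
  deriv_eq : ∀ i < 2 * n, ∀ s ∈ Set.Ioo (t i) (t (i + 1)), deriv γ s = r s • deriv u s
  ratio : ∀ i < 2 * n, IsStraightArc u (t i) (t (i + 1)) →
    ∃ ρ : ℝ, ∀ s ∈ Set.Ioo (t i) (t (i + 1)), r s = ρ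

/-- The closed curve `γ` on `[0, 2 T]` is convex: it has a supporting line `γ s + ℝ w` through each
of its points `γ s`. -/
def IsConvexCurve (T : ℝ) (γ : ℝ → ℝ × ℝ) : Prop :=
  ∀ s ∈ Set.Icc 0 (2 * T), ∃ w : ℝ × ℝ, w ≠ 0 ∧
    ∀ s' ∈ Set.Icc 0 (2 * T), 0 ≤ det w (γ s' - γ s)

/-- The dual length `L_*` of an admissible curve with curvature radius `r`. -/
noncomputable def dualLength (T : ℝ) (u : ℝ → ℝ × ℝ) (r : ℝ → ℝ) : ℝ :=
  ∫ s in (0 : ℝ)..(2 * T), r s * det (u s) (deriv u s)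

/-- The mixed area of two curves on `[0, 2 T]`. -/
noncomputable def mixedArea (T : ℝ) (γ₁ γ₂ : ℝ → ℝ × ℝ) : ℝ :=
  (1 / 2) * ∫ s in (0 : ℝ)..(2 * T), det (γ₁ s) (deriv γ₂ s)

/-- The signed area of a curve on `[0, 2 T]`. -/
noncomputable def signedArea (T : ℝ) (γ : ℝ → ℝ × ℝ) : ℝ := mixedArea T γ γ

/-- The area of the unit ball. -/
noncomputable def ballArea (N : Seminorm ℝ (ℝ × ℝ)) : ℝ := volume.real (unitBall N)

end NormedPlane

/-!
The inequality is Minkowski's: with `M (γ₁, γ₂) = ½ ∫ [γ₁, γ₂']` for the mixed area, the dual length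
is `L = 2 M (u, γ)`, the ball has area `A_U = M (u, u)` (`IsUnitCircle.two_mul_ballArea`), and
`γ - k u` has area `A_γ - k L + k² A_U`. It is therefore enough to find one `k` for which `γ - k u`
has area at most zero, since `A_γ ≤ k L - k² A_U ≤ L² / (4 A_U)`.

To find it, choose a direction in which `u` has a unique highest point `f` and a unique lowest point
`-f` (`IsUnitCircle.exists_isHeightExtremal`), let `k` be the ratio of the widths of `γ` and `u` in
that direction, and put `v = γ - k u`. Let `y` be the coordinate of `v` along `f`, measured from its
common value at the two extremal parameters, and `x` the coordinate across. Up to a positive factor,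
twice the area of `v` is `-∫ 2 y x'`. As `v' = σ u'`, the curve `v` has `x' = m y'` with `m` the
slope of the tangent of `u`, so

  `2 y x' = (y² m)' - y² m'`.

The unit circle turns to the left, so, away from `± f`, `m' ≤ 0` and `m` does not rise at the
vertices. At `± f` the slope may be infinite, but there `y² m` tends to zero because `y` has at
least a double zero against a simple pole; if the slope is finite, `y² m` is zero with `y`. Hence
`∫ 2 y x' ≥ 0` (`IsHeightExtremal.flux_sub_le` on the arcs, `IsHeightExtremal.flux_next_le` at the
vertices, `IsHeightExtremal.sum_integral_nonneg` around the circle).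

In the case of equality `y² m' = 0` on the arcs and `y = 0` wherever `m` jumps. So `y` vanishes on
the strictly convex arcs and, two consecutive sides not being collinear, at all vertices. Since `σ`
is constant over a side and no side is orthogonal to `f`, this forces `σ = 0`, and `v` is constant
(`IsHeightExtremal.eq_of_sum_integral_eq_zero`).
-/

namespace NormedPlane

/-! ### Curves that are smooth by parts -/

/-- The derivative of `c` on the closed piece `[t i, t (i + 1)]`, one-sided at the two ends. -/
noncomputable def pieceDeriv (t : ℕ → ℝ) (c : ℝ → ℝ × ℝ) (i : ℕ) : ℝ → ℝ × ℝ :=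
  derivWithin c (Set.Icc (t i) (t (i + 1)))

section Subdivision

variable {n : ℕ} {T : ℝ} {t : ℕ → ℝ}

lemma IsSubdivision.mono (h : IsSubdivision n T t) {i j : ℕ} (hij : i ≤ j) (hj : j ≤ 2 * n) :
    t i ≤ t j := by
  induction j, hij using Nat.le_induction with
  | base => exact le_rfl
  | succ k hk ih => exact (ih (by omega)).trans (h.lt k (by omega)).le

lemma IsSubdivision.Icc_subset (h : IsSubdivision n T t) {i : ℕ} (hi : i < 2 * n) :
    Set.Icc (t i) (t (i + 1)) ⊆ Set.Icc 0 (2 * T) := by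
  rw [← h.first, ← h.last]
  exact Set.Icc_subset_Icc (h.mono (Nat.zero_le i) hi.le) (h.mono hi le_rfl)

lemma IsSubdivision.n_pos (h : IsSubdivision n T t) : 0 < n := by
  rcases Nat.eq_zero_or_pos n with rfl | hn
  · have h1 := h.first
    have h2 := h.last
    have h3 := h.pos
    simp only [mul_zero] at h2
    linarith
  · exact hn

lemma IsSubdivision.exists_mem_Ico (h : IsSubdivision n T t) {s : ℝ}
    (hs : s ∈ Set.Ico 0 (2 * T)) : ∃ i < 2 * n, s ∈ Set.Ico (t i) (t (i + 1)) := by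
  by_contra! H
  have key : ∀ k ≤ 2 * n, t k ≤ s := by
    intro k hk
    induction k with
    | zero => rw [h.first]; exact hs.1
    | succ k ih =>
      by_contra hlt
      exact H k (by omega) ⟨ih (by omega), not_le.mp hlt⟩
  have := key (2 * n) le_rfl
  rw [h.last] at this
  exact absurd hs.2 (not_lt.mpr this)

lemma IsSubdivision.exists_mem_Ioo (h : IsSubdivision n T t) {s : ℝ}
    (hs : s ∈ Set.Ico 0 (2 * T)) (hs' : s ∉ Set.range t) :
    ∃ i < 2 * n, s ∈ Set.Ioo (t i) (t (i + 1)) := by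
  obtain ⟨i, hi, hsi⟩ := h.exists_mem_Ico hs
  exact ⟨i, hi, lt_of_le_of_ne hsi.1 fun e => hs' ⟨i, e⟩, hsi.2⟩

lemma IsSubdivision.uniqueDiffOn (h : IsSubdivision n T t) {i : ℕ} (hi : i < 2 * n) :
    UniqueDiffOn ℝ (Set.Icc (t i) (t (i + 1))) :=
  uniqueDiffOn_Icc (h.lt i hi)

lemma SmoothByParts.continuousOn {c : ℝ → ℝ × ℝ} (hc : SmoothByParts n t c)
    (h : IsSubdivision n T t) : ContinuousOn c (Set.Icc 0 (2 * T)) := by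
  have key : ∀ k ≤ 2 * n, ContinuousOn c (Set.Icc (t 0) (t k)) := by
    intro k hk
    induction k with
    | zero => simp
    | succ k ih =>
      rw [← Set.Icc_union_Icc_eq_Icc (h.mono (Nat.zero_le k) (by omega)) (h.lt k (by omega)).le]
      exact (ih (by omega)).union_of_isClosed (hc k (by omega)).continuousOn isClosed_Icc
        isClosed_Icc
  rw [← h.first, ← h.last]
  exact key _ le_rfl

lemma SmoothByParts.hasDerivWithinAt {c : ℝ → ℝ × ℝ} (hc : SmoothByParts n t c) {i : ℕ}
    (hi : i < 2 * n) {s : ℝ} (hs : s ∈ Set.Icc (t i) (t (i + 1))) :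
    HasDerivWithinAt c (pieceDeriv t c i s) (Set.Icc (t i) (t (i + 1))) s :=
  ((hc i hi).differentiableOn (by simp) s hs).hasDerivWithinAt

lemma SmoothByParts.hasDerivAt {c : ℝ → ℝ × ℝ} (hc : SmoothByParts n t c) {i : ℕ}
    (hi : i < 2 * n) {s : ℝ} (hs : s ∈ Set.Ioo (t i) (t (i + 1))) :
    HasDerivAt c (pieceDeriv t c i s) s :=
  (hc.hasDerivWithinAt hi (Set.Ioo_subset_Icc_self hs)).hasDerivAt (Icc_mem_nhds hs.1 hs.2)

lemma SmoothByParts.contDiffOn_pieceDeriv {c : ℝ → ℝ × ℝ} (hc : SmoothByParts n t c)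
    (h : IsSubdivision n T t) {i : ℕ} (hi : i < 2 * n) :
    ContDiffOn ℝ ∞ (pieceDeriv t c i) (Set.Icc (t i) (t (i + 1))) :=
  (hc i hi).derivWithin (h.uniqueDiffOn hi) (by simp)

lemma SmoothByParts.continuousOn_pieceDeriv {c : ℝ → ℝ × ℝ} (hc : SmoothByParts n t c)
    (h : IsSubdivision n T t) {i : ℕ} (hi : i < 2 * n) :
    ContinuousOn (pieceDeriv t c i) (Set.Icc (t i) (t (i + 1))) :=
  (hc.contDiffOn_pieceDeriv h hi).continuousOn

lemma SmoothByParts.const_smul_sub {c d : ℝ → ℝ × ℝ} (hc : SmoothByParts n t c)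
    (hd : SmoothByParts n t d) (k : ℝ) : SmoothByParts n t fun s => c s - k • d s :=
  fun i hi => (hc i hi).sub ((hd i hi).const_smul k)

/-! ### Integration over the pieces -/

section Integral

variable {f : ℝ → ℝ} {g : ℕ → ℝ → ℝ}

lemma intervalIntegrable_piece (h : IsSubdivision n T t) {i : ℕ} (hi : i < 2 * n)
    (hg : ContinuousOn (g i) (Set.Icc (t i) (t (i + 1))))
    (hfg : Set.EqOn f (g i) (Set.Ioo (t i) (t (i + 1)))) :
    IntervalIntegrable f volume (t i) (t (i + 1)) := by
  have h1 : IntervalIntegrable (g i) volume (t i) (t (i + 1)) :=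
    hg.intervalIntegrable_of_Icc (h.lt i hi).le
  refine h1.congr_ae ?_
  rw [Set.uIoc_of_le (h.lt i hi).le, ← restrict_Ioo_eq_restrict_Ioc]
  exact (ae_restrict_iff' measurableSet_Ioo).2 (Filter.Eventually.of_forall
    fun s hs => (hfg hs).symm)

lemma integral_piece (h : IsSubdivision n T t) {i : ℕ} (hi : i < 2 * n)
    (hfg : Set.EqOn f (g i) (Set.Ioo (t i) (t (i + 1)))) :
    ∫ s in (t i)..(t (i + 1)), f s = ∫ s in (t i)..(t (i + 1)), g i s := by
  refine intervalIntegral.integral_congr_ae_restrict ?_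
  rw [Set.uIoc_of_le (h.lt i hi).le, ← restrict_Ioo_eq_restrict_Ioc]
  exact (ae_restrict_iff' measurableSet_Ioo).2 (Filter.Eventually.of_forall
    fun s hs => hfg hs)

lemma intervalIntegrable_of_pieces (h : IsSubdivision n T t)
    (hg : ∀ i < 2 * n, ContinuousOn (g i) (Set.Icc (t i) (t (i + 1))))
    (hfg : ∀ i < 2 * n, Set.EqOn f (g i) (Set.Ioo (t i) (t (i + 1)))) :
    IntervalIntegrable f volume 0 (2 * T) := by
  have := IntervalIntegrable.trans_iterate (f := f) (μ := volume) (a := t) (n := 2 * n)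
    fun i hi => intervalIntegrable_piece h hi (hg i hi) (hfg i hi)
  rwa [h.first, h.last] at this

lemma integral_eq_sum_pieces (h : IsSubdivision n T t)
    (hg : ∀ i < 2 * n, ContinuousOn (g i) (Set.Icc (t i) (t (i + 1))))
    (hfg : ∀ i < 2 * n, Set.EqOn f (g i) (Set.Ioo (t i) (t (i + 1)))) :
    ∫ s in (0 : ℝ)..(2 * T), f s
      = ∑ i ∈ Finset.range (2 * n), ∫ s in (t i)..(t (i + 1)), g i s := by
  have := intervalIntegral.sum_integral_adjacent_intervals (f := f) (μ := volume) (a := t)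
    (n := 2 * n) fun i hi => intervalIntegrable_piece h hi (hg i hi) (hfg i hi)
  rw [← h.first, ← h.last, ← this]
  exact Finset.sum_congr rfl fun i hi => integral_piece h (Finset.mem_range.1 hi)
    (hfg i (Finset.mem_range.1 hi))

lemma integral_eq_sub_of_pieces {F : ℝ → ℝ} (h : IsSubdivision n T t)
    (hg : ∀ i < 2 * n, ContinuousOn (g i) (Set.Icc (t i) (t (i + 1))))
    (hfg : ∀ i < 2 * n, Set.EqOn f (g i) (Set.Ioo (t i) (t (i + 1))))
    (hF : ContinuousOn F (Set.Icc 0 (2 * T)))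
    (hFg : ∀ i < 2 * n, ∀ s ∈ Set.Ioo (t i) (t (i + 1)), HasDerivAt F (g i s) s) :
    ∫ s in (0 : ℝ)..(2 * T), f s = F (2 * T) - F 0 := by
  rw [integral_eq_sum_pieces h hg hfg, ← h.first, ← h.last,
    ← Finset.sum_range_sub fun k => F (t k)]
  refine Finset.sum_congr rfl fun i hi => ?_
  have hi := Finset.mem_range.1 hi
  exact intervalIntegral.integral_eq_sub_of_hasDerivAt_of_le (h.lt i hi).le
    (hF.mono (h.Icc_subset hi)) (hFg i hi)
    ((hg i hi).intervalIntegrable_of_Icc (h.lt i hi).le)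

end Integral

end Subdivision

/-! ### The unit ball and its supporting lines -/

section Ball

variable (N : Seminorm ℝ (ℝ × ℝ))

lemma continuous_seminorm : Continuous N := by
  have hle : ∀ x : ℝ × ℝ, N x ≤ |x.1| * N (1, 0) + |x.2| * N (0, 1) := by
    intro x
    calc N x = N (x.1 • (1, 0) + x.2 • (0, 1)) := by simp
      _ ≤ N (x.1 • (1, 0)) + N (x.2 • (0, 1)) := map_add_le_add N _ _
      _ = _ := by rw [map_smul_eq_mul, map_smul_eq_mul, Real.norm_eq_abs, Real.norm_eq_abs]
  apply Seminorm.continuous_of_continuousAt_zero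
  have h0 : Filter.Tendsto (fun x : ℝ × ℝ => |x.1| * N (1, 0) + |x.2| * N (0, 1))
      (nhds 0) (nhds 0) := by
    have : Continuous fun x : ℝ × ℝ => |x.1| * N (1, 0) + |x.2| * N (0, 1) := by fun_prop
    simpa using this.tendsto 0
  rw [ContinuousAt, map_zero]
  exact squeeze_zero (fun x => apply_nonneg N x) hle h0

lemma unitBall_eq : unitBall N = {x | N x ≤ 1} := by
  ext x
  simp [unitBall]

lemma frontier_unitBall : frontier (unitBall N) = {x | N x = 1} := by
  rw [unitBall_eq]
  apply Set.Subset.antisymm (frontier_le_subset_eq (continuous_seminorm N) continuous_const)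
  intro x hx
  have hx : N x = 1 := hx
  rw [frontier_eq_closure_inter_closure]
  refine ⟨subset_closure hx.le, ?_⟩
  have ht : Filter.Tendsto (fun k : ℝ => k • x) (nhdsWithin 1 (Set.Ioi 1)) (nhds x) := by
    have : Continuous fun k : ℝ => k • x := by fun_prop
    simpa using (this.tendsto 1).mono_left nhdsWithin_le_nhds
  refine mem_closure_of_tendsto ht ?_
  filter_upwards [self_mem_nhdsWithin] with k hk
  have hk : (1 : ℝ) < k := hk
  change ¬ N (k • x) ≤ 1
  rw [map_smul_eq_mul, hx, mul_one, Real.norm_eq_abs, abs_of_pos (by linarith)]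
  linarith

/-- Through each point `z` of the unit circle there is a supporting line of the unit ball, given by
a linear functional. -/
lemma exists_supporting_functional {z : ℝ × ℝ} (hz : N z = 1) :
    ∃ g : StrongDual ℝ (ℝ × ℝ), 0 < g z ∧ ∀ x, N x ≤ 1 → g x ≤ g z := by
  have hopen : IsOpen (N.ball 0 1) := by
    rw [Seminorm.ball_zero_eq]
    exact isOpen_lt (continuous_seminorm N) continuous_const
  obtain ⟨g, hg⟩ := geometric_hahn_banach_open_point (N.convex_ball 0 1) hopen
    (x := z) (by rw [Seminorm.mem_ball_zero, hz]; exact lt_irrefl 1)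
  refine ⟨g, by simpa using hg 0 (by simp), fun x hx => ?_⟩
  have ht : Filter.Tendsto (fun k : ℝ => k * g x) (nhdsWithin 1 (Set.Iio 1)) (nhds (g x)) := by
    have : Continuous fun k : ℝ => k * g x := by fun_prop
    simpa using (this.tendsto 1).mono_left nhdsWithin_le_nhds
  refine le_of_tendsto ht ?_
  filter_upwards [Ioo_mem_nhdsLT (show (0 : ℝ) < 1 by norm_num)] with k hk
  have : g (k • x) < g z := by
    apply hg
    rw [Seminorm.mem_ball_zero, map_smul_eq_mul, Real.norm_eq_abs, abs_of_pos hk.1]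
    nlinarith [hk.1, hk.2, apply_nonneg N x]
  rw [map_smul, smul_eq_mul] at this
  exact this.le

end Ball

section UnitCircle

variable {N : Seminorm ℝ (ℝ × ℝ)} {n : ℕ} {T : ℝ} {t : ℕ → ℝ} {u : ℝ → ℝ × ℝ}

lemma IsUnitCircle.seminorm_eq_one (hu : IsUnitCircle N n T t u) {s : ℝ}
    (hs : s ∈ Set.Icc 0 (2 * T)) : N (u s) = 1 := by
  have : u s ∈ frontier (unitBall N) := hu.image_eq ▸ Set.mem_image_of_mem u hs
  rwa [frontier_unitBall] at this

lemma IsUnitCircle.exists_eq (hu : IsUnitCircle N n T t u) {x : ℝ × ℝ} (hx : N x = 1) :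
    ∃ s ∈ Set.Icc 0 (2 * T), u s = x := by
  have : x ∈ u '' Set.Icc 0 (2 * T) := by
    rw [hu.image_eq, frontier_unitBall]
    exact hx
  exact this

lemma IsUnitCircle.det_pos (hu : IsUnitCircle N n T t u) {i : ℕ} (hi : i < 2 * n) {s : ℝ}
    (hs : s ∈ Set.Icc (t i) (t (i + 1))) : 0 < det (u s) (pieceDeriv t u i s) :=
  hu.counterclockwise i hi s hs

/-- Two parameters with the same value are equal, or are the two ends of the parameter interval. -/
lemma IsUnitCircle.eq_or_ends (hu : IsUnitCircle N n T t u) {s s' : ℝ}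
    (hs : s ∈ Set.Icc 0 (2 * T)) (hs' : s' ∈ Set.Icc 0 (2 * T)) (h : u s = u s') :
    s = s' ∨ (s = 0 ∧ s' = 2 * T) ∨ (s = 2 * T ∧ s' = 0) := by
  have hT := hu.subdivision.pos
  rcases eq_or_lt_of_le hs.2 with rfl | h1 <;> rcases eq_or_lt_of_le hs'.2 with rfl | h2
  · exact Or.inl rfl
  · rw [← hu.closed] at h
    have := hu.injOn ⟨le_rfl, by linarith⟩ ⟨hs'.1, h2⟩ h
    exact Or.inr (Or.inr ⟨rfl, this.symm⟩)
  · rw [← hu.closed] at h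
    have := hu.injOn ⟨hs.1, h1⟩ ⟨le_rfl, by linarith⟩ h
    exact Or.inr (Or.inl ⟨this, rfl⟩)
  · exact Or.inl (hu.injOn ⟨hs.1, h1⟩ ⟨hs'.1, h2⟩ h)

/-- The one-sided tangents of the unit circle are supporting lines of it. -/
lemma IsUnitCircle.supporting (hu : IsUnitCircle N n T t u) {i : ℕ} (hi : i < 2 * n) {s s' : ℝ}
    (hs : s ∈ Set.Icc (t i) (t (i + 1))) (hs' : s' ∈ Set.Icc 0 (2 * T)) :
    0 ≤ det (pieceDeriv t u i s) (u s' - u s) := by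
  have hsub := hu.subdivision
  have hcl : closure (Set.Ioo (t i) (t (i + 1))) = Set.Icc (t i) (t (i + 1)) :=
    closure_Ioo (hsub.lt i hi).ne
  have hcu : ContinuousOn u (Set.Icc (t i) (t (i + 1))) := (hu.smooth i hi).continuousOn
  have hcd := hu.smooth.continuousOn_pieceDeriv hsub hi
  refine le_on_closure (s := Set.Ioo (t i) (t (i + 1))) (f := fun _ => (0 : ℝ))
    (g := fun s => det (pieceDeriv t u i s) (u s' - u s)) ?_ continuousOn_const ?_ (hcl ▸ hs)
  · intro s hs
    have hsI := Set.Ioo_subset_Icc_self hs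
    obtain ⟨g, hg0, hg⟩ := exists_supporting_functional N
      (hu.seminorm_eq_one (hsub.Icc_subset hi hsI))
    have hmax : IsLocalMax (fun x => g (u x)) s := by
      filter_upwards [Ioo_mem_nhds hs.1 hs.2] with x hx
      exact hg _ (hu.seminorm_eq_one (hsub.Icc_subset hi (Set.Ioo_subset_Icc_self hx))).le
    have hder : g (pieceDeriv t u i s) = 0 :=
      hmax.hasDerivAt_eq_zero (g.hasFDerivAt.comp_hasDerivAt s (hu.smooth.hasDerivAt hi hs))
    have hrep : ∀ x : ℝ × ℝ, g x = x.1 * g (1, 0) + x.2 * g (0, 1) := by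
      intro x
      conv_lhs => rw [show x = x.1 • (1, 0) + x.2 • (0, 1) by simp]
      rw [map_add, map_smul, map_smul, smul_eq_mul, smul_eq_mul]
    have hle : g (u s' - u s) ≤ 0 := by
      rw [map_sub]
      linarith [hg (u s') (hu.seminorm_eq_one hs').le]
    have hpos := hu.det_pos hi hsI
    -- `g` and `det · u'` both vanish on the tangent `u'`, so they are proportional
    have hprop : g (u s' - u s) * det (u s) (pieceDeriv t u i s)
        = -(g (u s) * det (pieceDeriv t u i s) (u s' - u s)) := by
      rw [hrep] at hder
      rw [hrep (u s' - u s), hrep (u s)]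
      simp only [det, Prod.fst_sub, Prod.snd_sub]
      linear_combination ((u s).1 * ((u s').2 - (u s).2) - (u s).2 * ((u s').1 - (u s).1)) * hder
    by_contra hneg
    have hneg := not_le.1 hneg
    nlinarith [mul_nonpos_of_nonpos_of_nonneg hle hpos.le, mul_neg_of_pos_of_neg hg0 hneg]
  · rw [hcl]
    simp only [det, Prod.fst_sub, Prod.snd_sub]
    fun_prop

/-- The second derivative of `c` on the closed piece `[t i, t (i + 1)]`. -/
noncomputable def pieceDeriv₂ (t : ℕ → ℝ) (c : ℝ → ℝ × ℝ) (i : ℕ) : ℝ → ℝ × ℝ :=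
  derivWithin (pieceDeriv t c i) (Set.Icc (t i) (t (i + 1)))

lemma iteratedDerivWithin_two_eq (c : ℝ → ℝ × ℝ) (i : ℕ) (s : ℝ) :
    iteratedDerivWithin 2 c (Set.Icc (t i) (t (i + 1))) s = pieceDeriv₂ t c i s := by
  rw [iteratedDerivWithin_succ, iteratedDerivWithin_one]
  rfl

lemma SmoothByParts.hasDerivWithinAt_pieceDeriv (hu : SmoothByParts n t u)
    (h : IsSubdivision n T t) {i : ℕ} (hi : i < 2 * n) {s : ℝ}
    (hs : s ∈ Set.Icc (t i) (t (i + 1))) :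
    HasDerivWithinAt (pieceDeriv t u i) (pieceDeriv₂ t u i s) (Set.Icc (t i) (t (i + 1))) s :=
  ((hu.contDiffOn_pieceDeriv h hi).differentiableOn (by simp) s hs).hasDerivWithinAt

lemma nhdsWithin_Icc_diff_neBot {a b s : ℝ} (hab : a < b) (hs : s ∈ Set.Icc a b) :
    (nhdsWithin s (Set.Icc a b \ {s})).NeBot := by
  rw [← accPt_principal_iff_nhdsWithin]
  exact (uniqueDiffOn_Icc hab s hs).accPt

/-- The unit circle turns to the left: supporting lines at two neighbouring points give
`[u' (s) - u' (s'), u (s') - u (s)] ≥ 0`, and `s' → s` after division by `(s' - s) ^ 2`. -/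
lemma IsUnitCircle.det_pieceDeriv₂_nonneg (hu : IsUnitCircle N n T t u) {i : ℕ} (hi : i < 2 * n)
    {s : ℝ} (hs : s ∈ Set.Icc (t i) (t (i + 1))) :
    0 ≤ det (pieceDeriv t u i s) (pieceDeriv₂ t u i s) := by
  have hsub := hu.subdivision
  have h1 := hasDerivWithinAt_iff_tendsto_slope.1 (hu.smooth.hasDerivWithinAt hi hs)
  have h2 := hasDerivWithinAt_iff_tendsto_slope.1
    (hu.smooth.hasDerivWithinAt_pieceDeriv hsub hi hs)
  have := nhdsWithin_Icc_diff_neBot (hsub.lt i hi) hs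
  have hcont : Continuous fun z : (ℝ × ℝ) × (ℝ × ℝ) => det z.1 z.2 := by
    unfold det
    fun_prop
  have ht := (hcont.tendsto _).comp (h1.prodMk_nhds h2)
  refine ge_of_tendsto ht ?_
  filter_upwards [self_mem_nhdsWithin] with s' hs'
  have k1 := hu.supporting hi hs (hsub.Icc_subset hi hs'.1)
  have k2 := hu.supporting hi hs'.1 (hsub.Icc_subset hi hs)
  have e : det (slope u s s') (slope (pieceDeriv t u i) s s')
      = ((s' - s)⁻¹) ^ 2 * (det (pieceDeriv t u i s) (u s' - u s)
        + det (pieceDeriv t u i s') (u s - u s')) := by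
    simp only [slope, vsub_eq_sub, det, Prod.smul_fst, Prod.smul_snd, Prod.fst_sub,
      Prod.snd_sub, smul_eq_mul]
    ring
  change 0 ≤ det (slope u s s') (slope (pieceDeriv t u i) s s')
  rw [e]
  exact mul_nonneg (sq_nonneg _) (add_nonneg k1 k2)

/-- The tangents of a straight arc are parallel to it. -/
lemma IsUnitCircle.det_straight (hu : IsUnitCircle N n T t u) {i : ℕ} (hi : i < 2 * n)
    (hst : IsStraightArc u (t i) (t (i + 1))) {s : ℝ} (hs : s ∈ Set.Icc (t i) (t (i + 1))) :
    det (u (t (i + 1)) - u (t i)) (pieceDeriv t u i s) = 0 := by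
  set d := u (t (i + 1)) - u (t i) with hd
  have hconst : ∀ x ∈ Set.Icc (t i) (t (i + 1)), det d (u x) = det d (u (t i)) := by
    intro x hx
    have hx' : u x ∈ segment ℝ (u (t i)) (u (t (i + 1))) :=
      hst ▸ Set.mem_image_of_mem u hx
    rw [segment_eq_image'] at hx'
    obtain ⟨θ, -, hθ⟩ := hx'
    simp only at hθ
    rw [← hθ, ← hd]
    simp only [det, Prod.fst_add, Prod.snd_add, Prod.smul_fst, Prod.smul_snd, smul_eq_mul]
    ring
  have hder := hu.smooth.hasDerivWithinAt hi hs
  have h1 : HasDerivWithinAt (fun x => det d (u x)) (det d (pieceDeriv t u i s))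
      (Set.Icc (t i) (t (i + 1))) s := by
    have hf := (hasFDerivAt_fst (𝕜 := ℝ) (p := u s)).comp_hasDerivWithinAt s hder
    have hg := (hasFDerivAt_snd (𝕜 := ℝ) (p := u s)).comp_hasDerivWithinAt s hder
    exact (hg.const_mul d.1).sub (hf.const_mul d.2)
  have h2 : HasDerivWithinAt (fun x => det d (u x)) 0 (Set.Icc (t i) (t (i + 1))) s :=
    (hasDerivWithinAt_const s _ (det d (u (t i)))).congr hconst (hconst s hs)
  exact (hu.subdivision.uniqueDiffOn hi s hs).eq_deriv _ h1 h2

end UnitCircle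

/-! ### The area of the unit ball -/

section Area

variable {N : Seminorm ℝ (ℝ × ℝ)} {n : ℕ} {T : ℝ} {t : ℕ → ℝ} {u : ℝ → ℝ × ℝ}

lemma volume_span_singleton (v : ℝ × ℝ) :
    volume (Submodule.span ℝ {v} : Set (ℝ × ℝ)) = 0 := by
  apply Measure.addHaar_submodule
  intro h
  have h1 := finrank_span_le_card (R := ℝ) ({v} : Set (ℝ × ℝ))
  rw [h, finrank_top] at h1
  simp at h1

/-- Almost all of the unit ball is swept out by the rays `ρ • u s` with `0 < ρ < 1`, for `s` off the
ends of the pieces. -/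
lemma IsUnitCircle.image_polar_ae_eq (hN : ∀ x, N x = 0 → x = 0) (hu : IsUnitCircle N n T t u) :
    (fun z : ℝ × ℝ => z.1 • u z.2) '' (Set.Ioo 0 1 ×ˢ (Set.Ioo 0 (2 * T) \ Set.range t))
      =ᵐ[volume] unitBall N := by
  have hsub := hu.subdivision
  have hincl : (fun z : ℝ × ℝ => z.1 • u z.2) ''
      (Set.Ioo 0 1 ×ˢ (Set.Ioo 0 (2 * T) \ Set.range t)) ⊆ unitBall N := by
    rintro _ ⟨⟨ρ, s⟩, ⟨hρ, hs, -⟩, rfl⟩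
    rw [unitBall_eq]
    change N (ρ • u s) ≤ 1
    rw [map_smul_eq_mul, hu.seminorm_eq_one (Set.Ioo_subset_Icc_self hs), mul_one,
      Real.norm_eq_abs, abs_of_pos hρ.1]
    exact hρ.2.le
  refine hincl.eventuallyLE.antisymm ?_
  rw [ae_le_set]
  have hnull : volume (frontier (unitBall N) ∪
      ⋃ k, (Submodule.span ℝ {u (t k)} : Set (ℝ × ℝ))) = 0 := by
    refine measure_union_null ?_ (measure_iUnion_null fun k => volume_span_singleton _)
    exact (N.convex_closedBall 0 1).addHaar_frontier volume
  refine measure_mono_null ?_ hnull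
  rintro x ⟨hx, hx'⟩
  have hx1 : N x ≤ 1 := by rwa [unitBall_eq] at hx
  rcases eq_or_lt_of_le hx1 with h1 | h1
  · exact Or.inl (by rw [frontier_unitBall]; exact h1)
  right
  rw [Set.mem_iUnion]
  by_cases h0 : N x = 0
  · exact ⟨0, by rw [hN x h0]; exact zero_mem _⟩
  have hpos : 0 < N x := lt_of_le_of_ne (apply_nonneg N x) (Ne.symm h0)
  obtain ⟨s, hs, hsx⟩ := hu.exists_eq (x := (N x)⁻¹ • x) (by
    rw [map_smul_eq_mul, Real.norm_eq_abs, abs_of_pos (inv_pos.2 hpos), inv_mul_cancel₀ h0])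
  have hxs : N x • u s = x := by rw [hsx, smul_smul, mul_inv_cancel₀ h0, one_smul]
  by_cases hst : s ∈ Set.range t
  · obtain ⟨k, rfl⟩ := hst
    exact ⟨k, by rw [← hxs]; exact Submodule.smul_mem _ _ (Submodule.mem_span_singleton_self _)⟩
  · refine absurd ⟨(N x, s), ⟨⟨hpos, h1⟩, ⟨?_, ?_⟩, hst⟩, hxs⟩ hx'
    · exact lt_of_le_of_ne hs.1 fun e => hst ⟨0, hsub.first.trans e⟩
    · exact lt_of_le_of_ne hs.2 fun e => hst ⟨2 * n, hsub.last.trans e.symm⟩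

lemma IsUnitCircle.injOn_polar (hu : IsUnitCircle N n T t u) :
    Set.InjOn (fun z : ℝ × ℝ => z.1 • u z.2)
      (Set.Ioo 0 1 ×ˢ (Set.Ioo 0 (2 * T) \ Set.range t)) := by
  rintro ⟨ρ, s⟩ ⟨hρ, hs, -⟩ ⟨ρ', s'⟩ ⟨hρ', hs', -⟩ h
  simp only at h hρ hρ' hs hs'
  have hNeq := congrArg N h
  simp only [map_smul_eq_mul, Real.norm_eq_abs, abs_of_pos hρ.1, abs_of_pos hρ'.1,
    hu.seminorm_eq_one (Set.Ioo_subset_Icc_self hs),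
    hu.seminorm_eq_one (Set.Ioo_subset_Icc_self hs'), mul_one] at hNeq
  subst hNeq
  have := smul_right_injective (ℝ × ℝ) hρ.1.ne' h
  rw [hu.injOn (Set.Ioo_subset_Ico_self hs) (Set.Ioo_subset_Ico_self hs') this]

lemma SmoothByParts.hasDerivAt_deriv (hu : SmoothByParts n t u) {i : ℕ} (hi : i < 2 * n) {s : ℝ}
    (hs : s ∈ Set.Ioo (t i) (t (i + 1))) : HasDerivAt u (deriv u s) s :=
  (hu.hasDerivAt hi hs).differentiableAt.hasDerivAt

/-- The area of the unit ball is `½ ∫ [u, u']`, by the change of variables `(ρ, s) ↦ ρ • u s`, of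
Jacobian determinant `ρ [u, u']`. -/
lemma IsUnitCircle.two_mul_ballArea (hN : ∀ x, N x = 0 → x = 0) (hu : IsUnitCircle N n T t u) :
    2 * ballArea N = ∫ s in (0 : ℝ)..(2 * T), det (u s) (deriv u s) := by
  have hsub := hu.subdivision
  set A : Set ℝ := Set.Ioo 0 (2 * T) \ Set.range t with hA
  have hAm : MeasurableSet A := measurableSet_Ioo.diff (Set.countable_range t).measurableSet
  let f' : ℝ × ℝ → (ℝ × ℝ →L[ℝ] ℝ × ℝ) := fun z =>
    (Matrix.toLin (.finTwoProd ℝ) (.finTwoProd ℝ)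
      !![(u z.2).1, z.1 * (deriv u z.2).1; (u z.2).2, z.1 * (deriv u z.2).2]).toContinuousLinearMap
  have hpiece : ∀ s ∈ A, ∃ i < 2 * n, s ∈ Set.Ioo (t i) (t (i + 1)) := fun s hs =>
    hsub.exists_mem_Ioo (Set.Ioo_subset_Ico_self hs.1) hs.2
  have hf' : ∀ z ∈ Set.Ioo (0 : ℝ) 1 ×ˢ A, HasFDerivWithinAt (fun z : ℝ × ℝ => z.1 • u z.2) (f' z)
      (Set.Ioo (0 : ℝ) 1 ×ˢ A) z := by
    rintro z ⟨-, hz⟩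
    obtain ⟨i, hi, hzi⟩ := hpiece _ hz
    have hd := hu.smooth.hasDerivAt_deriv hi hzi
    apply HasFDerivAt.hasFDerivWithinAt
    have h2 : HasFDerivAt (fun z : ℝ × ℝ => u z.2) _ z :=
      hd.hasFDerivAt.comp z hasFDerivAt_snd
    convert! (hasFDerivAt_fst (𝕜 := ℝ) (p := z)).smul h2 using 1
    ext <;> simp [f', Matrix.toLin_apply, Matrix.mulVec, dotProduct, Fin.sum_univ_two]
  have hdet : ∀ z, (f' z).det = z.1 * det (u z.2) (deriv u z.2) := by
    intro z
    simp only [f', LinearMap.det_toContinuousLinearMap, LinearMap.det_toLin,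
      Matrix.det_fin_two_of, det]
    ring
  have hcv := integral_image_eq_integral_abs_det_fderiv_smul volume
    (measurableSet_Ioo.prod hAm) hf' hu.injOn_polar (fun _ => (1 : ℝ))
  have hleft : ∫ _ in (fun z : ℝ × ℝ => z.1 • u z.2) '' (Set.Ioo (0 : ℝ) 1 ×ˢ A), (1 : ℝ)
      = ballArea N := by
    rw [setIntegral_congr_set (hu.image_polar_ae_eq hN), setIntegral_const, smul_eq_mul, mul_one,
      ballArea]
  have hright : ∫ z in Set.Ioo (0 : ℝ) 1 ×ˢ A, |(f' z).det| • (1 : ℝ)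
      = ∫ z in Set.Ioo (0 : ℝ) 1 ×ˢ A, z.1 * det (u z.2) (deriv u z.2) := by
    refine setIntegral_congr_fun (measurableSet_Ioo.prod hAm) fun z hz => ?_
    obtain ⟨i, hi, hzi⟩ := hpiece _ hz.2
    simp only [hdet, smul_eq_mul, mul_one]
    rw [(hu.smooth.hasDerivAt hi hzi).deriv]
    exact abs_of_nonneg (mul_nonneg hz.1.1.le (hu.det_pos hi (Set.Ioo_subset_Icc_self hzi)).le)
  have hprod : ∫ z in Set.Ioo (0 : ℝ) 1 ×ˢ A, z.1 * det (u z.2) (deriv u z.2)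
      = (∫ ρ in Set.Ioo (0 : ℝ) 1, ρ) * ∫ s in A, det (u s) (deriv u s) := by
    rw [Measure.volume_eq_prod]
    exact setIntegral_prod_mul (fun ρ : ℝ => ρ) (fun s => det (u s) (deriv u s)) _ _
  have hhalf : ∫ ρ in Set.Ioo (0 : ℝ) 1, ρ = 1 / 2 := by
    rw [← integral_Ioc_eq_integral_Ioo, ← intervalIntegral.integral_of_le zero_le_one]
    simp
  have hAint : ∫ s in A, det (u s) (deriv u s)
      = ∫ s in (0 : ℝ)..(2 * T), det (u s) (deriv u s) := by
    rw [intervalIntegral.integral_of_le (by linarith [hsub.pos]), integral_Ioc_eq_integral_Ioo]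
    exact setIntegral_congr_set (sdiff_null_ae_eq_self ((Set.countable_range t).measure_zero _))
  rw [← hleft, hcv, hright, hprod, hhalf, hAint]
  ring

end Area

/-! ### The flux and its derivative on a piece -/

/-- The Euclidean scalar product with `f`: the height in the direction `f`. -/
def height (f x : ℝ × ℝ) : ℝ := f.1 * x.1 + f.2 * x.2

/-- The bracket in the orthogonal coordinates `det · f` and `height f ·`, which are dilated by
`|f|`. -/
lemma det_mul_height (f p q : ℝ × ℝ) :
    det p q * height f f = det p f * height f q - det q f * height f p := by
  simp only [det, height]
  ring

lemma height_smul (f x : ℝ × ℝ) (k : ℝ) : height f (k • x) = k * height f x := by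
  simp only [height, Prod.smul_fst, Prod.smul_snd, smul_eq_mul]
  ring

lemma height_sub (f x y : ℝ × ℝ) : height f (x - y) = height f x - height f y := by
  simp only [height, Prod.fst_sub, Prod.snd_sub]
  ring

lemma height_neg_self (f : ℝ × ℝ) : height f (-f) = -height f f := by
  simp only [height, Prod.fst_neg, Prod.snd_neg]
  ring

lemma det_smul_left (x f : ℝ × ℝ) (k : ℝ) : det (k • x) f = k * det x f := by
  simp only [det, Prod.smul_fst, Prod.smul_snd, smul_eq_mul]
  ring

lemma height_self_pos {f : ℝ × ℝ} (hf : f ≠ 0) : 0 < height f f := by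
  have h : f.1 ≠ 0 ∨ f.2 ≠ 0 := by
    by_contra! h
    exact hf (Prod.ext h.1 h.2)
  rcases h with h | h <;> simp only [height]
  · nlinarith [mul_self_pos.2 h, mul_self_nonneg f.2]
  · nlinarith [mul_self_pos.2 h, mul_self_nonneg f.1]

lemma eq_zero_of_height_of_det {f q : ℝ × ℝ} (hf : f ≠ 0) (h1 : height f q = 0)
    (h2 : det q f = 0) : q = 0 := by
  have hD := height_self_pos hf
  simp only [height, det] at h1 h2 hD
  refine Prod.ext ?_ ?_
  · have : q.1 * (f.1 * f.1 + f.2 * f.2) = 0 := by linear_combination f.1 * h1 + f.2 * h2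
    exact (mul_eq_zero.1 this).resolve_right hD.ne'
  · have : q.2 * (f.1 * f.1 + f.2 * f.2) = 0 := by linear_combination f.2 * h1 - f.1 * h2
    exact (mul_eq_zero.1 this).resolve_right hD.ne'

lemma _root_.HasDerivWithinAt.height {c : ℝ → ℝ × ℝ} {c' : ℝ × ℝ} {P : Set ℝ} {s : ℝ}
    (hc : HasDerivWithinAt c c' P s) (f : ℝ × ℝ) :
    HasDerivWithinAt (fun x => height f (c x)) (height f c') P s := by
  have h1 := (hasFDerivAt_fst (𝕜 := ℝ) (p := c s)).comp_hasDerivWithinAt s hc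
  have h2 := (hasFDerivAt_snd (𝕜 := ℝ) (p := c s)).comp_hasDerivWithinAt s hc
  exact (h1.const_mul f.1).add (h2.const_mul f.2)

lemma _root_.HasDerivWithinAt.det_const {c : ℝ → ℝ × ℝ} {c' : ℝ × ℝ} {P : Set ℝ} {s : ℝ}
    (hc : HasDerivWithinAt c c' P s) (f : ℝ × ℝ) :
    HasDerivWithinAt (fun x => det (c x) f) (det c' f) P s := by
  have h1 := (hasFDerivAt_fst (𝕜 := ℝ) (p := c s)).comp_hasDerivWithinAt s hc
  have h2 := (hasFDerivAt_snd (𝕜 := ℝ) (p := c s)).comp_hasDerivWithinAt s hc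
  exact (h1.mul_const f.2).sub (h2.mul_const f.1)

/-- The derivative of `y² a / b` when `y' = σ b`. The formula persists at a simple zero `s` of `b`
with `y s = 0`: there both quotients by `b s` are zero by convention, and `y ^ 2 / b` tends to zero
faster than linearly. -/
lemma hasDerivWithinAt_sq_mul_div {P : Set ℝ} {s : ℝ} {a b y : ℝ → ℝ} {a' b' σ : ℝ}
    (ha : HasDerivWithinAt a a' P s) (hb : HasDerivWithinAt b b' P s)
    (hy : HasDerivWithinAt y (σ * b s) P s)
    (h0 : b s = 0 → y s = 0 ∧ b' ≠ 0) :
    HasDerivWithinAt (fun x => y x ^ 2 * a x / b x)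
      (2 * y s * (σ * a s) - y s ^ 2 * (a s * b' - a' * b s) / b s ^ 2) P s := by
  by_cases hbs : b s = 0
  · obtain ⟨hys, hb'⟩ := h0 hbs
    have hzero : 2 * y s * (σ * a s) - y s ^ 2 * (a s * b' - a' * b s) / b s ^ 2 = 0 := by
      simp [hys]
    rw [hzero, hasDerivWithinAt_iff_tendsto_slope]
    rw [hbs, mul_zero] at hy
    have k1 := hasDerivWithinAt_iff_tendsto_slope.1 hy
    have k2 := hasDerivWithinAt_iff_tendsto_slope.1 hb
    have k3 : Filter.Tendsto a (nhdsWithin s (P \ {s})) (nhds (a s)) :=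
      ha.continuousWithinAt.mono Set.sdiff_subset
    have k4 := ((k1.pow 2).mul k3).mul (k2.inv₀ hb')
    simp only [ne_eq, OfNat.ofNat_ne_zero, not_false_eq_true, zero_pow, zero_mul] at k4
    refine k4.congr' ?_
    filter_upwards [self_mem_nhdsWithin] with x hx
    have hxs : x - s ≠ 0 := sub_ne_zero.2 hx.2
    simp only [slope, vsub_eq_sub, smul_eq_mul, hys, hbs, sub_zero, div_zero, mul_inv, inv_inv]
    field_simp
  · convert! ((hy.pow 2).mul ha).div hb hbs using 1
    simp only [Pi.pow_apply, Pi.mul_apply]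
    field_simp
    ring

/-- If `F' = g - k` with `k ≥ 0`, then `F` grows by at most `∫ g`, and by less unless `k = 0`. -/
lemma sub_le_integral_of_deriv {p q : ℝ} (hpq : p < q) {F g k : ℝ → ℝ}
    (hg : ContinuousOn g (Set.Icc p q))
    (hF : ∀ s ∈ Set.Icc p q, HasDerivWithinAt F (g s - k s) (Set.Icc p q) s)
    (hk : ∀ s ∈ Set.Icc p q, 0 ≤ k s) :
    F q - F p ≤ ∫ s in p..q, g s ∧
      (F q - F p = ∫ s in p..q, g s → ∀ s ∈ Set.Ioo p q, k s = 0) := by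
  have hgi : IntervalIntegrable g volume p q := hg.intervalIntegrable_of_Icc hpq.le
  set G : ℝ → ℝ := fun x => (∫ s in p..x, g s) - F x with hG
  have hGc : ContinuousOn G (Set.Icc p q) := by
    refine ContinuousOn.sub ?_ fun s hs => (hF s hs).continuousWithinAt
    rw [← Set.uIcc_of_le hpq.le]
    exact intervalIntegral.continuousOn_primitive_interval' hgi Set.left_mem_uIcc
  have hGd : ∀ s ∈ Set.Ioo p q, HasDerivAt G (k s) s := by
    intro s hs
    have hgs : IntervalIntegrable g volume p s :=
      (hg.mono (Set.Icc_subset_Icc_right hs.2.le)).intervalIntegrable_of_Icc hs.1.le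
    have h1 := intervalIntegral.integral_hasDerivAt_right hgs
      ((hg.mono Set.Ioo_subset_Icc_self).stronglyMeasurableAtFilter isOpen_Ioo s hs)
      (hg.continuousAt (Icc_mem_nhds hs.1 hs.2))
    have h2 := (hF s (Set.Ioo_subset_Icc_self hs)).hasDerivAt (Icc_mem_nhds hs.1 hs.2)
    have h3 := h1.sub h2
    rw [sub_sub_cancel] at h3
    exact h3
  have hmono : MonotoneOn G (Set.Icc p q) := by
    refine monotoneOn_of_hasDerivWithinAt_nonneg (convex_Icc p q) hGc
      (f' := k) (fun s hs => ?_) fun s hs => ?_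
    · rw [interior_Icc] at hs ⊢
      exact (hGd s hs).hasDerivWithinAt
    · rw [interior_Icc] at hs
      exact hk s (Set.Ioo_subset_Icc_self hs)
  have hp := Set.left_mem_Icc.2 hpq.le
  have hq := Set.right_mem_Icc.2 hpq.le
  have hpG : G p = -F p := by simp [hG]
  have hle := hmono hp hq hpq.le
  refine ⟨by rw [hpG] at hle; simp only [hG] at hle; linarith, fun heq s hs => ?_⟩
  have hqG : G q = G p := by
    rw [hpG, hG]
    simp only
    linarith
  have hconst : G =ᶠ[nhds s] fun _ => G p := by
    filter_upwards [Ioo_mem_nhds hs.1 hs.2] with x hx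
    have hxI := Set.Ioo_subset_Icc_self hx
    exact le_antisymm ((hmono hxI hq hx.2.le).trans hqG.le) (hmono hp hxI hx.1.le)
  exact (hGd s hs).unique ((hasDerivAt_const s (G p)).congr_of_eventuallyEq hconst)

section Flux

variable {N : Seminorm ℝ (ℝ × ℝ)} {n : ℕ} {T : ℝ} {t : ℕ → ℝ} {u v : ℝ → ℝ × ℝ}

/-- The vector `f` is a point of the unit circle, and the circle has `f` as its only highest and
`-f` as its only lowest point in the direction `f`. -/
structure IsHeightExtremal (N : Seminorm ℝ (ℝ × ℝ)) (T : ℝ) (u : ℝ → ℝ × ℝ) (f : ℝ × ℝ) :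
    Prop where
  ne_zero : f ≠ 0
  seminorm_eq_one : N f = 1
  extremal : ∀ s ∈ Set.Icc 0 (2 * T),
    |height f (u s)| ≤ height f f ∧ (|height f (u s)| = height f f → u s = f ∨ u s = -f)

/-- A point of the unit circle farthest from the origin, for the Euclidean norm, is extremal. -/
lemma IsUnitCircle.exists_isHeightExtremal (hu : IsUnitCircle N n T t u) :
    ∃ f : ℝ × ℝ, IsHeightExtremal N T u f := by
  have hsub := hu.subdivision
  have hcu := hu.smooth.continuousOn hsub
  have hcont : ContinuousOn (fun s => height (u s) (u s)) (Set.Icc 0 (2 * T)) := by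
    simp only [height]
    fun_prop
  obtain ⟨s₀, hs₀, hmax⟩ := isCompact_Icc.exists_isMaxOn
    (Set.nonempty_Icc.2 (by linarith [hsub.pos])) hcont
  have hmax : ∀ s ∈ Set.Icc 0 (2 * T), height (u s) (u s) ≤ height (u s₀) (u s₀) :=
    fun s hs => hmax hs
  have hN1 := hu.seminorm_eq_one hs₀
  refine ⟨u s₀, fun h => ?_, hN1, fun s hs => ?_⟩
  · rw [h, map_zero] at hN1
    exact zero_ne_one hN1
  have hm := hmax s hs
  simp only [height] at hm ⊢
  generalize u s₀ = f at hm ⊢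
  generalize u s = x at hm ⊢
  refine ⟨abs_le.2 ⟨?_, ?_⟩, fun h => ?_⟩
  · nlinarith [sq_nonneg (f.1 + x.1), sq_nonneg (f.2 + x.2)]
  · nlinarith [sq_nonneg (f.1 - x.1), sq_nonneg (f.2 - x.2)]
  · rcases abs_choice (f.1 * x.1 + f.2 * x.2) with h' | h' <;> rw [h'] at h
    · left
      have : (f.1 - x.1) ^ 2 + (f.2 - x.2) ^ 2 ≤ 0 := by nlinarith
      exact Prod.ext (by nlinarith [sq_nonneg (f.1 - x.1), sq_nonneg (f.2 - x.2)])
        (by nlinarith [sq_nonneg (f.1 - x.1), sq_nonneg (f.2 - x.2)])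
    · right
      have : (f.1 + x.1) ^ 2 + (f.2 + x.2) ^ 2 ≤ 0 := by nlinarith
      refine Prod.ext ?_ ?_ <;> simp only [Prod.fst_neg, Prod.snd_neg]
      · nlinarith [sq_nonneg (f.1 + x.1), sq_nonneg (f.2 + x.2)]
      · nlinarith [sq_nonneg (f.1 + x.1), sq_nonneg (f.2 + x.2)]

end Flux

section Flux

variable {N : Seminorm ℝ (ℝ × ℝ)} {n : ℕ} {T : ℝ} {t : ℕ → ℝ} {u v : ℝ → ℝ × ℝ} {f : ℝ × ℝ}

/-- The velocity of `v` is a multiple of that of `u`, at the ends of the pieces also for the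
one-sided velocities. -/
def IsParallel (n : ℕ) (t : ℕ → ℝ) (u v : ℝ → ℝ × ℝ) : Prop :=
  ∀ i < 2 * n, ∀ s ∈ Set.Icc (t i) (t (i + 1)),
    ∃ σ : ℝ, pieceDeriv t v i s = σ • pieceDeriv t u i s

/-- For the slope `m = x' / y'` of the tangent of `u`, in coordinates with `y` along `f`, the
function `y² m` of the curve `v`, on the piece `i`; `h` is the level from which `y` is measured.
Where the tangent is orthogonal to `f`, the value is zero by convention. -/
noncomputable def flux (t : ℕ → ℝ) (u v : ℝ → ℝ × ℝ) (f : ℝ × ℝ) (h : ℝ) (i : ℕ) (s : ℝ) : ℝ :=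
  (height f (v s) - h) ^ 2 * det (pieceDeriv t u i s) f / height f (pieceDeriv t u i s)

/-- A line through a point of the unit circle that is orthogonal to `f` and supports the circle
touches it at `f` or `-f`. -/
lemma IsHeightExtremal.eq_of_supporting (hu : IsUnitCircle N n T t u)
    (hf : IsHeightExtremal N T u f) {s : ℝ} (hs : s ∈ Set.Icc 0 (2 * T)) {q : ℝ × ℝ} (hq : q ≠ 0)
    (hq0 : height f q = 0) (hsupp : ∀ s' ∈ Set.Icc 0 (2 * T), 0 ≤ det q (u s' - u s)) :
    u s = f ∨ u s = -f := by
  have hD := height_self_pos hf.ne_zero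
  have hκ : det q f ≠ 0 := fun h => hq (eq_zero_of_height_of_det hf.ne_zero hq0 h)
  have key : ∀ s' ∈ Set.Icc 0 (2 * T), 0 ≤ det q f * (height f (u s') - height f (u s)) := by
    intro s' hs'
    have h1 := mul_nonneg (hsupp s' hs') hD.le
    rwa [det_mul_height, hq0, mul_zero, sub_zero, height_sub] at h1
  have hle := abs_le.1 (hf.extremal s hs).1
  apply (hf.extremal s hs).2
  rcases lt_or_gt_of_ne hκ with hneg | hpos
  · obtain ⟨s', hs', e⟩ := hu.exists_eq hf.seminorm_eq_one
    have h2 := key s' hs'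
    rw [e] at h2
    have h3 : height f f ≤ height f (u s) := by nlinarith
    rw [le_antisymm hle.2 h3, abs_of_pos hD]
  · obtain ⟨s', hs', e⟩ := hu.exists_eq (x := -f) (by rw [map_neg_eq_map, hf.seminorm_eq_one])
    have h2 := key s' hs'
    have e2 : height f (-f) = -height f f := height_neg_self f
    rw [e, e2] at h2
    have h3 : height f (u s) ≤ -height f f := by nlinarith
    rw [le_antisymm h3 hle.1, abs_neg, abs_of_pos hD]

lemma IsHeightExtremal.eq_of_height_eq_zero (hu : IsUnitCircle N n T t u)
    (hf : IsHeightExtremal N T u f) {i : ℕ} (hi : i < 2 * n) {s : ℝ}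
    (hs : s ∈ Set.Icc (t i) (t (i + 1))) (h0 : height f (pieceDeriv t u i s) = 0) :
    u s = f ∨ u s = -f :=
  hf.eq_of_supporting hu (hu.subdivision.Icc_subset hi hs) (hu.deriv_ne_zero i hi s hs) h0
    fun _ hs' => hu.supporting hi hs hs'

lemma IsUnitCircle.straight_ne (hu : IsUnitCircle N n T t u) {i : ℕ} (hi : i < 2 * n)
    (hst : IsStraightArc u (t i) (t (i + 1))) : u (t (i + 1)) - u (t i) ≠ 0 := by
  intro h
  have hle := (hu.subdivision.lt i hi).le
  have hl := Set.left_mem_Icc.2 hle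
  apply hu.deriv_ne_zero i hi (t i) hl
  have hconst : ∀ x ∈ Set.Icc (t i) (t (i + 1)), u x = u (t i) := by
    intro x hx
    have hx' : u x ∈ segment ℝ (u (t i)) (u (t (i + 1))) := hst ▸ Set.mem_image_of_mem u hx
    rwa [sub_eq_zero.1 h, segment_same] at hx'
  rw [derivWithin_congr hconst (hconst _ hl)]
  simp

lemma exists_smul_eq_of_det_eq_zero {d q : ℝ × ℝ} (hd : d ≠ 0) (h : det d q = 0) :
    ∃ k : ℝ, q = k • d := by
  have hD := height_self_pos hd
  refine ⟨height d q / height d d, ?_⟩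
  simp only [height, det] at *
  refine Prod.ext ?_ ?_ <;> simp only [Prod.smul_fst, Prod.smul_snd, smul_eq_mul] <;>
    rw [div_mul_eq_mul_div, eq_div_iff hD.ne']
  · linear_combination (-d.2) * h
  · linear_combination d.1 * h

/-- The tangents at two points of a straight arc are parallel. -/
lemma IsUnitCircle.exists_smul_of_straight (hu : IsUnitCircle N n T t u) {i : ℕ} (hi : i < 2 * n)
    (hst : IsStraightArc u (t i) (t (i + 1))) {s s' : ℝ} (hs : s ∈ Set.Icc (t i) (t (i + 1)))
    (hs' : s' ∈ Set.Icc (t i) (t (i + 1))) :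
    ∃ k : ℝ, pieceDeriv t u i s' = k • pieceDeriv t u i s := by
  have hd := hu.straight_ne hi hst
  obtain ⟨k, hk⟩ := exists_smul_eq_of_det_eq_zero hd (hu.det_straight hi hst hs)
  obtain ⟨k', hk'⟩ := exists_smul_eq_of_det_eq_zero hd (hu.det_straight hi hst hs')
  have hk0 : k ≠ 0 := by
    rintro rfl
    exact hu.deriv_ne_zero i hi s hs (by rw [zero_smul] at hk; exact hk)
  exact ⟨k' / k, by rw [hk', hk, smul_smul, div_mul_cancel₀ _ hk0]⟩

/-- The derivative of the flux is `2 y x' - y² [u', u''] |f|² / (height of u')²`. -/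
lemma IsHeightExtremal.hasDerivWithinAt_flux (hu : IsUnitCircle N n T t u)
    (hf : IsHeightExtremal N T u f) (hv : SmoothByParts n t v) (hpar : IsParallel n t u v) {h : ℝ}
    (h0 : ∀ s ∈ Set.Icc 0 (2 * T), (u s = f ∨ u s = -f) → height f (v s) = h) {i : ℕ}
    (hi : i < 2 * n) {s : ℝ} (hs : s ∈ Set.Icc (t i) (t (i + 1))) :
    HasDerivWithinAt (flux t u v f h i)
      (2 * (height f (v s) - h) * det (pieceDeriv t v i s) f
        - (height f (v s) - h) ^ 2
          * (det (pieceDeriv t u i s) (pieceDeriv₂ t u i s) * height f f)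
          / height f (pieceDeriv t u i s) ^ 2) (Set.Icc (t i) (t (i + 1))) s := by
  have hsub := hu.subdivision
  obtain ⟨σ, hσ⟩ := hpar i hi s hs
  have hu2 := hu.smooth.hasDerivWithinAt_pieceDeriv hsub hi hs
  have hy : HasDerivWithinAt (fun x => height f (v x) - h)
      (σ * height f (pieceDeriv t u i s)) (Set.Icc (t i) (t (i + 1))) s := by
    have := ((hv.hasDerivWithinAt hi hs).height f).sub_const h
    rwa [hσ, height_smul] at this
  by_cases hcase : height f (pieceDeriv t u i s) = 0 ∧ IsStraightArc u (t i) (t (i + 1))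
  · -- on a straight arc orthogonal to `f` the flux vanishes, by convention
    obtain ⟨hb, hst⟩ := hcase
    have hall : ∀ x ∈ Set.Icc (t i) (t (i + 1)), flux t u v f h i x = 0 := by
      intro x hx
      obtain ⟨k, hk⟩ := hu.exists_smul_of_straight hi hst hs hx
      rw [flux, hk, height_smul, hb, mul_zero, div_zero]
    have hys := h0 s (hsub.Icc_subset hi hs) (hf.eq_of_height_eq_zero hu hi hs hb)
    rw [hys, sub_self, mul_zero, zero_mul, zero_pow two_ne_zero, zero_mul, zero_div, sub_zero]
    exact (hasDerivWithinAt_const s (Set.Icc (t i) (t (i + 1))) (0 : ℝ)).congr hall (hall s hs)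
  · have := hasDerivWithinAt_sq_mul_div (hu2.det_const f) (hu2.height f) hy fun hb => by
      refine ⟨?_, fun hb' => ?_⟩
      · rw [h0 s (hsub.Icc_subset hi hs) (hf.eq_of_height_eq_zero hu hi hs hb), sub_self]
      · have harc := (hu.arcs i hi).resolve_left fun hst => hcase ⟨hb, hst⟩
        refine harc s hs ?_
        have e := det_mul_height f (pieceDeriv t u i s) (pieceDeriv₂ t u i s)
        rw [hb, hb', mul_zero, mul_zero, sub_zero] at e
        rw [iteratedDerivWithin_two_eq]
        exact (mul_eq_zero.1 e).resolve_right (height_self_pos hf.ne_zero).ne'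
    convert! this using 2
    · rw [hσ, det_smul_left]
    · rw [det_mul_height]

/-- The flux grows over a piece by at most `∫ 2 y x'`, and by less over a strictly convex arc on
which `y` is not zero. -/
lemma IsHeightExtremal.flux_sub_le (hu : IsUnitCircle N n T t u)
    (hf : IsHeightExtremal N T u f) (hv : SmoothByParts n t v) (hpar : IsParallel n t u v) {h : ℝ}
    (h0 : ∀ s ∈ Set.Icc 0 (2 * T), (u s = f ∨ u s = -f) → height f (v s) = h) {i : ℕ}
    (hi : i < 2 * n) :
    flux t u v f h i (t (i + 1)) - flux t u v f h i (t i)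
        ≤ ∫ s in (t i)..(t (i + 1)), 2 * (height f (v s) - h) * det (pieceDeriv t v i s) f ∧
      (flux t u v f h i (t (i + 1)) - flux t u v f h i (t i)
          = ∫ s in (t i)..(t (i + 1)), 2 * (height f (v s) - h) * det (pieceDeriv t v i s) f →
        IsStrictlyConvexArc u (t i) (t (i + 1)) →
        ∀ s ∈ Set.Icc (t i) (t (i + 1)), height f (v s) = h) := by
  have hsub := hu.subdivision
  have hD := height_self_pos hf.ne_zero
  have hcv : ContinuousOn v (Set.Icc (t i) (t (i + 1))) := (hv i hi).continuousOn
  have hcd := hv.continuousOn_pieceDeriv hsub hi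
  obtain ⟨h1, h2⟩ := sub_le_integral_of_deriv (hsub.lt i hi) (F := flux t u v f h i)
    (g := fun s => 2 * (height f (v s) - h) * det (pieceDeriv t v i s) f)
    (by simp only [height, det]; fun_prop)
    (fun s hs => hf.hasDerivWithinAt_flux hu hv hpar h0 hi hs)
    (fun s hs => div_nonneg (mul_nonneg (sq_nonneg _)
      (mul_nonneg (hu.det_pieceDeriv₂_nonneg hi hs) hD.le)) (sq_nonneg _))
  refine ⟨h1, fun heq harc => ?_⟩
  have hopen : ∀ s ∈ Set.Ioo (t i) (t (i + 1)), height f (v s) = h := by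
    intro s hs
    have hsI := Set.Ioo_subset_Icc_self hs
    have hne : det (pieceDeriv t u i s) (pieceDeriv₂ t u i s) ≠ 0 := by
      rw [← iteratedDerivWithin_two_eq]
      exact harc s hsI
    by_cases hb : height f (pieceDeriv t u i s) = 0
    · exact h0 s (hsub.Icc_subset hi hsI) (hf.eq_of_height_eq_zero hu hi hsI hb)
    · have := h2 heq s hs
      rw [div_eq_zero_iff, mul_eq_zero, mul_eq_zero] at this
      rcases this with (h3 | h3 | h3) | h3
      · exact sub_eq_zero.1 (pow_eq_zero_iff (two_ne_zero) |>.1 h3)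
      · exact absurd h3 hne
      · exact absurd h3 hD.ne'
      · exact absurd (pow_eq_zero_iff (two_ne_zero) |>.1 h3) hb
  have hcl : closure (Set.Ioo (t i) (t (i + 1))) = Set.Icc (t i) (t (i + 1)) :=
    closure_Ioo (hsub.lt i hi).ne
  have hch : ContinuousOn (fun s => height f (v s)) (closure (Set.Ioo (t i) (t (i + 1)))) := by
    rw [hcl]
    simp only [height]
    fun_prop
  intro s hs
  rw [← hcl] at hs
  exact le_antisymm (le_on_closure (fun x hx => (hopen x hx).le) hch continuousOn_const hs)
    (le_on_closure (fun x hx => (hopen x hx).ge) continuousOn_const hch hs)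

end Flux

/-! ### The flux around the whole circle -/

section Jump

variable {N : Seminorm ℝ (ℝ × ℝ)} {n : ℕ} {T : ℝ} {t : ℕ → ℝ} {u v : ℝ → ℝ × ℝ} {f : ℝ × ℝ}

lemma IsUnitCircle.next_lt (hu : IsUnitCircle N n T t u) (i : ℕ) :
    (i + 1) % (2 * n) < 2 * n :=
  Nat.mod_lt _ (by have := hu.subdivision.n_pos; omega)

lemma IsSubdivision.apply_next {E : Type*} (h : IsSubdivision n T t) {c : ℝ → E}
    (hc : c 0 = c (2 * T)) {i : ℕ} (hi : i < 2 * n) :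
    c (t ((i + 1) % (2 * n))) = c (t (i + 1)) := by
  rcases eq_or_lt_of_le (Nat.succ_le_of_lt hi) with he | hlt
  · rw [← Nat.succ_eq_add_one, he, Nat.mod_self, h.first, h.last, hc]
  · rw [Nat.mod_eq_of_lt hlt]

/-- The left and right tangents at a vertex form a left turn. -/
lemma IsUnitCircle.det_tangents_nonneg (hu : IsUnitCircle N n T t u) {i j : ℕ} (hi : i < 2 * n)
    (hj : j < 2 * n) (hij : u (t j) = u (t (i + 1))) :
    0 ≤ det (pieceDeriv t u i (t (i + 1))) (pieceDeriv t u j (t j)) := by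
  have hsub := hu.subdivision
  have hr := Set.right_mem_Icc.2 (hsub.lt i hi).le
  have hl := Set.left_mem_Icc.2 (hsub.lt j hj).le
  set q := pieceDeriv t u j (t j) with hq
  have hd := (hu.smooth.hasDerivWithinAt hi hr).det_const q
  have := nhdsWithin_Icc_diff_neBot (hsub.lt i hi) hr
  refine ge_of_tendsto (hasDerivWithinAt_iff_tendsto_slope.1 hd) ?_
  filter_upwards [self_mem_nhdsWithin] with x hx
  have hxlt : x < t (i + 1) := lt_of_le_of_ne hx.1.2 hx.2
  have hs := hu.supporting hj hl (hsub.Icc_subset hi hx.1)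
  rw [hij, ← hq] at hs
  have e : det (u x) q - det (u (t (i + 1))) q = -det q (u x - u (t (i + 1))) := by
    simp only [det, Prod.fst_sub, Prod.snd_sub]
    ring
  simp only [slope, vsub_eq_sub, smul_eq_mul]
  rw [e]
  exact mul_nonneg_of_nonpos_of_nonpos (inv_nonpos.2 (by linarith)) (by linarith)

/-- The flux does not rise at a vertex. If it stays the same, `y` is zero there or the two tangents
are parallel. -/
lemma IsHeightExtremal.flux_next_le (hu : IsUnitCircle N n T t u)
    (hf : IsHeightExtremal N T u f) {h : ℝ}
    (h0 : ∀ s ∈ Set.Icc 0 (2 * T), (u s = f ∨ u s = -f) → height f (v s) = h)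
    {i j : ℕ} (hi : i < 2 * n) (hj : j < 2 * n) (hij : u (t j) = u (t (i + 1)))
    (hvij : v (t j) = v (t (i + 1))) :
    flux t u v f h j (t j) ≤ flux t u v f h i (t (i + 1)) ∧
      (flux t u v f h j (t j) = flux t u v f h i (t (i + 1)) →
        height f (v (t (i + 1))) = h ∨
          det (pieceDeriv t u i (t (i + 1))) (pieceDeriv t u j (t j)) = 0) := by
  have hsub := hu.subdivision
  have hr := Set.right_mem_Icc.2 (hsub.lt i hi).le
  have hl := Set.left_mem_Icc.2 (hsub.lt j hj).le
  have hD := height_self_pos hf.ne_zero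
  have hdet := hu.det_tangents_nonneg hi hj hij
  have hp1 := hu.det_pos hi hr
  have hp2 := hu.det_pos hj hl
  have hs1 := fun s' (hs' : s' ∈ Set.Icc 0 (2 * T)) => hu.supporting hi hr hs'
  have hs2 := fun s' (hs' : s' ∈ Set.Icc 0 (2 * T)) => hu.supporting hj hl hs'
  have hz1 := fun hb => hf.eq_of_height_eq_zero hu hi hr hb
  have hz2 := fun hb => hf.eq_of_height_eq_zero hu hj hl hb
  have hmem := hsub.Icc_subset hi hr
  simp only [flux]
  rw [hvij]
  rw [hij] at hp2 hs2 hz2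
  generalize pieceDeriv t u i (t (i + 1)) = q₁ at *
  generalize pieceDeriv t u j (t j) = q₂ at *
  by_cases hy : height f (v (t (i + 1))) = h
  · simp [hy]
  have hnot : ¬ (u (t (i + 1)) = f ∨ u (t (i + 1)) = -f) := fun hc => hy (h0 _ hmem hc)
  have hb1 : height f q₁ ≠ 0 := fun hb => hnot (hz1 hb)
  have hb2 : height f q₂ ≠ 0 := fun hb => hnot (hz2 hb)
  -- otherwise a positive combination of the two tangents is a supporting line orthogonal to `f`
  have hb12 : 0 < height f q₁ * height f q₂ := by
    by_contra hle
    have hneg : height f q₁ * height f q₂ < 0 :=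
      lt_of_le_of_ne (not_lt.1 hle) (mul_ne_zero hb1 hb2)
    have a1 := abs_pos.2 hb1
    have a2 := abs_pos.2 hb2
    have hlin : ∀ x : ℝ × ℝ, det (|height f q₂| • q₁ + |height f q₁| • q₂) x
        = |height f q₂| * det q₁ x + |height f q₁| * det q₂ x := by
      intro x
      simp only [det, Prod.fst_add, Prod.snd_add, Prod.smul_fst, Prod.smul_snd, smul_eq_mul]
      ring
    have hne : |height f q₂| • q₁ + |height f q₁| • q₂ ≠ 0 := by
      intro e
      have e1 := hlin (u (t (i + 1)))
      rw [e] at e1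
      simp only [det, Prod.fst_zero, Prod.snd_zero, zero_mul, sub_zero] at e1 hp1 hp2
      nlinarith [mul_pos a2 hp1, mul_pos a1 hp2]
    refine hnot (hf.eq_of_supporting hu hmem hne ?_ fun s' hs' => ?_)
    · have e : height f (|height f q₂| • q₁ + |height f q₁| • q₂)
          = |height f q₂| * height f q₁ + |height f q₁| * height f q₂ := by
        simp only [height, Prod.fst_add, Prod.snd_add, Prod.smul_fst, Prod.smul_snd, smul_eq_mul]
        ring
      rw [e]
      rcases mul_neg_iff.1 hneg with ⟨c1, c2⟩ | ⟨c1, c2⟩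
      · rw [abs_of_pos c1, abs_of_neg c2]
        ring
      · rw [abs_of_neg c1, abs_of_pos c2]
        ring
    · rw [hlin]
      exact add_nonneg (mul_nonneg a2.le (hs1 s' hs')) (mul_nonneg a1.le (hs2 s' hs'))
  have hdiff : (height f (v (t (i + 1))) - h) ^ 2 * det q₁ f / height f q₁
      - (height f (v (t (i + 1))) - h) ^ 2 * det q₂ f / height f q₂
      = (height f (v (t (i + 1))) - h) ^ 2 * (det q₁ q₂ * height f f)
        / (height f q₁ * height f q₂) := by
    rw [det_mul_height]
    field_simp
  have hy2 : 0 < (height f (v (t (i + 1))) - h) ^ 2 :=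
    lt_of_le_of_ne (sq_nonneg _) (Ne.symm (pow_ne_zero 2 (sub_ne_zero.2 hy)))
  refine ⟨?_, fun heq => Or.inr ?_⟩
  · rw [← sub_nonneg, hdiff]
    exact div_nonneg (mul_nonneg hy2.le (mul_nonneg hdet hD.le)) hb12.le
  · rw [← heq, sub_self, eq_comm, div_eq_zero_iff, or_iff_left hb12.ne'] at hdiff
    exact (mul_eq_zero.1 ((mul_eq_zero.1 hdiff).resolve_left hy2.ne')).resolve_right hD.ne'

lemma sum_next (m : ℕ) (g : ℕ → ℝ) :
    ∑ i ∈ Finset.range m, g ((i + 1) % m) = ∑ i ∈ Finset.range m, g i := by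
  cases m with
  | zero => simp
  | succ k =>
    rw [Finset.sum_range_succ, Nat.mod_self, Finset.sum_range_succ']
    congr 1
    refine Finset.sum_congr rfl fun i hi => ?_
    rw [Nat.mod_eq_of_lt (Nat.succ_lt_succ (Finset.mem_range.1 hi))]

/-- The sum of `∫ 2 y x'` over the pieces is not negative, because the flux rises by at most
`∫ 2 y x'` on the pieces and does not rise at the vertices. If the sum is zero, there is equality
everywhere around the circle. -/
lemma IsHeightExtremal.sum_integral_nonneg (hu : IsUnitCircle N n T t u)
    (hf : IsHeightExtremal N T u f) (hv : SmoothByParts n t v) (hpar : IsParallel n t u v)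
    (hclosed : v 0 = v (2 * T)) {h : ℝ}
    (h0 : ∀ s ∈ Set.Icc 0 (2 * T), (u s = f ∨ u s = -f) → height f (v s) = h) :
    0 ≤ ∑ i ∈ Finset.range (2 * n), ∫ s in (t i)..(t (i + 1)),
        2 * (height f (v s) - h) * det (pieceDeriv t v i s) f ∧
      (∑ i ∈ Finset.range (2 * n), ∫ s in (t i)..(t (i + 1)),
          2 * (height f (v s) - h) * det (pieceDeriv t v i s) f = 0 →
        (∀ i < 2 * n, IsStrictlyConvexArc u (t i) (t (i + 1)) →
          ∀ s ∈ Set.Icc (t i) (t (i + 1)), height f (v s) = h) ∧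
        (∀ i < 2 * n, height f (v (t (i + 1))) = h ∨
          det (pieceDeriv t u i (t (i + 1)))
            (pieceDeriv t u ((i + 1) % (2 * n)) (t ((i + 1) % (2 * n)))) = 0)) := by
  have hsub := hu.subdivision
  have hpiece := fun i (hi : i < 2 * n) => hf.flux_sub_le hu hv hpar h0 hi
  have hjump := fun i (hi : i < 2 * n) => hf.flux_next_le hu h0 hi (hu.next_lt i)
    (hsub.apply_next hu.closed hi) (hsub.apply_next hclosed hi)
  set I : ℕ → ℝ := fun i => ∫ s in (t i)..(t (i + 1)),
    2 * (height f (v s) - h) * det (pieceDeriv t v i s) f with hI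
  set a : ℕ → ℝ := fun i => flux t u v f h i (t i) with ha
  set b : ℕ → ℝ := fun i => flux t u v f h i (t (i + 1)) with hb
  have hA : ∀ i ∈ Finset.range (2 * n), 0 ≤ I i - (b i - a i) := fun i hi =>
    sub_nonneg.2 (hpiece i (Finset.mem_range.1 hi)).1
  have hB : ∀ i ∈ Finset.range (2 * n), 0 ≤ b i - a ((i + 1) % (2 * n)) := fun i hi =>
    sub_nonneg.2 (hjump i (Finset.mem_range.1 hi)).1
  have htot : ∑ i ∈ Finset.range (2 * n), I i = ∑ i ∈ Finset.range (2 * n), (I i - (b i - a i))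
      + ∑ i ∈ Finset.range (2 * n), (b i - a ((i + 1) % (2 * n))) := by
    simp only [Finset.sum_sub_distrib, sum_next]
    ring
  have hA0 := Finset.sum_nonneg hA
  have hB0 := Finset.sum_nonneg hB
  refine ⟨by rw [htot]; exact add_nonneg hA0 hB0, fun hzero => ?_⟩
  rw [htot] at hzero
  have hA1 := (Finset.sum_eq_zero_iff_of_nonneg hA).1 (by linarith)
  have hB1 := (Finset.sum_eq_zero_iff_of_nonneg hB).1 (by linarith)
  exact ⟨fun i hi => (hpiece i hi).2 (sub_eq_zero.1 (hA1 i (Finset.mem_range.2 hi))).symm,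
    fun i hi => (hjump i hi).2 (sub_eq_zero.1 (hB1 i (Finset.mem_range.2 hi))).symm⟩

end Jump

/-! ### The case of equality -/

section Equality

variable {N : Seminorm ℝ (ℝ × ℝ)} {n : ℕ} {T : ℝ} {t : ℕ → ℝ} {u v : ℝ → ℝ × ℝ} {f : ℝ × ℝ}

/-- Two consecutive sides make a corner: with parallel tangents at their common vertex they would
be collinear. -/
lemma IsUnitCircle.det_tangents_ne_zero (hu : IsUnitCircle N n T t u) {i j : ℕ} (hi : i < 2 * n)
    (hj : j < 2 * n) (hne : i ≠ j) (hij : u (t j) = u (t (i + 1)))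
    (hsi : IsStraightArc u (t i) (t (i + 1))) (hsj : IsStraightArc u (t j) (t (j + 1))) :
    det (pieceDeriv t u i (t (i + 1))) (pieceDeriv t u j (t j)) ≠ 0 := by
  intro h0
  have hsub := hu.subdivision
  have hr := Set.right_mem_Icc.2 (hsub.lt i hi).le
  have hl := Set.left_mem_Icc.2 (hsub.lt j hj).le
  obtain ⟨k, hk⟩ := exists_smul_eq_of_det_eq_zero (hu.deriv_ne_zero i hi _ hr) h0
  have swap : ∀ {d q : ℝ × ℝ}, det d q = 0 → det q d = 0 := by
    intro d q e
    simp only [det] at e ⊢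
    linarith
  obtain ⟨k₁, hk₁⟩ := exists_smul_eq_of_det_eq_zero (hu.deriv_ne_zero i hi _ hr)
    (swap (hu.det_straight hi hsi hr))
  obtain ⟨k₂, hk₂⟩ := exists_smul_eq_of_det_eq_zero (hu.deriv_ne_zero j hj _ hl)
    (swap (hu.det_straight hj hsj hl))
  change _ = k₁ • pieceDeriv t u i (t (i + 1)) at hk₁
  change _ = k₂ • pieceDeriv t u j (t j) at hk₂
  change _ = k • pieceDeriv t u i (t (i + 1)) at hk
  have hz : u (t (i + 1)) ∈ arc u (t i) (t (i + 1)) ∪ arc u (t j) (t (j + 1)) :=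
    Or.inl (Set.mem_image_of_mem u hr)
  refine hu.sides i hi j hj hne hsi hsj ((collinear_iff_of_mem hz).2
    ⟨pieceDeriv t u i (t (i + 1)), ?_⟩)
  rintro p (hp | hp)
  · rw [hsi, segment_eq_image'] at hp
    obtain ⟨θ, -, rfl⟩ := hp
    refine ⟨(θ - 1) * k₁, ?_⟩
    rw [mul_smul, ← hk₁, vadd_eq_add]
    module
  · rw [hsj, segment_eq_image'] at hp
    obtain ⟨θ, -, rfl⟩ := hp
    refine ⟨θ * k₂ * k, ?_⟩
    rw [mul_smul, ← hk, mul_smul, ← hk₂, vadd_eq_add, hij]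
    module

/-- No side is orthogonal to an extremal direction. -/
lemma IsHeightExtremal.height_ne_of_straight (hu : IsUnitCircle N n T t u)
    (hf : IsHeightExtremal N T u f) {i : ℕ} (hi : i < 2 * n)
    (hst : IsStraightArc u (t i) (t (i + 1))) :
    height f (u (t (i + 1))) ≠ height f (u (t i)) := by
  intro heq
  have hsub := hu.subdivision
  have hl := Set.left_mem_Icc.2 (hsub.lt i hi).le
  have hD := height_self_pos hf.ne_zero
  set d := u (t (i + 1)) - u (t i) with hd
  have hhd : height f d = 0 := by rw [hd, height_sub, heq, sub_self]
  have hf2 : height f (-f) = -height f f := height_neg_self f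
  have hval : ∀ x ∈ Set.Icc (t i) (t (i + 1)), (u x = f ∨ u x = -f) ∧
      height f (u x) = height f (u (t i)) := by
    intro x hx
    constructor
    · apply hf.eq_of_height_eq_zero hu hi hx
      obtain ⟨k, hk⟩ := exists_smul_eq_of_det_eq_zero (hu.straight_ne hi hst)
        (hu.det_straight hi hst hx)
      rw [hk, height_smul, hhd, mul_zero]
    · have hx' : u x ∈ segment ℝ (u (t i)) (u (t (i + 1))) := hst ▸ Set.mem_image_of_mem u hx
      rw [segment_eq_image'] at hx'
      obtain ⟨θ, -, hθ⟩ := hx'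
      have e : u x - u (t i) = θ • d := by rw [← hθ, hd]; module
      have e2 := height_sub f (u x) (u (t i))
      rw [e, height_smul, hhd, mul_zero] at e2
      linarith
  apply hu.deriv_ne_zero i hi (t i) hl
  have hconst : ∀ x ∈ Set.Icc (t i) (t (i + 1)), u x = u (t i) := by
    intro x hx
    obtain ⟨h1, h2⟩ := hval x hx
    rcases h1 with h1 | h1 <;> rcases (hval _ hl).1 with h3 | h3 <;> rw [h1, h3]
    · rw [h1, h3, hf2] at h2
      linarith
    · rw [h1, h3, hf2] at h2
      linarith
  rw [derivWithin_congr hconst (hconst _ hl)]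
  simp

/-- If the sum of `∫ 2 y x'` over the pieces is zero, the curve is constant: `y` is zero on the
strictly convex arcs and at all vertices, hence the velocity is zero on all arcs. -/
lemma IsHeightExtremal.eq_of_sum_integral_eq_zero (hu : IsUnitCircle N n T t u)
    (hf : IsHeightExtremal N T u f) (hv : SmoothByParts n t v) (hpar : IsParallel n t u v)
    (hclosed : v 0 = v (2 * T))
    (hratio : ∀ i < 2 * n, IsStraightArc u (t i) (t (i + 1)) →
      ∃ σ : ℝ, ∀ s ∈ Set.Ioo (t i) (t (i + 1)), pieceDeriv t v i s = σ • pieceDeriv t u i s)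
    {h : ℝ} (h0 : ∀ s ∈ Set.Icc 0 (2 * T), (u s = f ∨ u s = -f) → height f (v s) = h)
    (hzero : ∑ i ∈ Finset.range (2 * n), ∫ s in (t i)..(t (i + 1)),
          2 * (height f (v s) - h) * det (pieceDeriv t v i s) f = 0) :
    ∀ s ∈ Set.Icc 0 (2 * T), v s = v 0 := by
  have hsub := hu.subdivision
  obtain ⟨hstrict, hcorner⟩ := (hf.sum_integral_nonneg hu hv hpar hclosed h0).2 hzero
  have hend : ∀ i < 2 * n, height f (v (t (i + 1))) = h := by
    intro i hi
    rcases hu.arcs i hi with hsi | hci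
    · have hj := hu.next_lt i
      have hl := Set.left_mem_Icc.2 (hsub.lt _ hj).le
      rcases hu.arcs _ hj with hsj | hcj
      · refine (hcorner i hi).resolve_right
          (hu.det_tangents_ne_zero hi hj ?_ (hsub.apply_next hu.closed hi) hsi hsj)
        have hn := hsub.n_pos
        rcases eq_or_lt_of_le (Nat.succ_le_of_lt hi) with he | hlt
        · rw [← Nat.succ_eq_add_one, he, Nat.mod_self]
          omega
        · rw [Nat.mod_eq_of_lt hlt]
          omega
      · rw [← hsub.apply_next hclosed hi]
        exact hstrict _ hj hcj _ hl
    · exact hstrict i hi hci _ (Set.right_mem_Icc.2 (hsub.lt i hi).le)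
  have hstart : ∀ i < 2 * n, height f (v (t i)) = h := by
    intro i hi
    cases i with
    | zero =>
      have hlast := hend (2 * n - 1) (by omega)
      rwa [Nat.sub_add_cancel (by omega), hsub.last, ← hclosed, ← hsub.first] at hlast
    | succ k => exact hend k (by omega)
  have hderiv : ∀ i < 2 * n, ∀ s ∈ Set.Ioo (t i) (t (i + 1)), ¬ (u s = f ∨ u s = -f) →
      pieceDeriv t v i s = 0 := by
    intro i hi s hs hsf
    have hsI := Set.Ioo_subset_Icc_self hs
    rcases hu.arcs i hi with hsi | hci
    · obtain ⟨σ, hσ⟩ := hratio i hi hsi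
      have hvu : ContinuousOn (fun x => height f (v x) - σ * height f (u x))
          (Set.Icc (t i) (t (i + 1))) := by
        have h1 : ContinuousOn v (Set.Icc (t i) (t (i + 1))) := (hv i hi).continuousOn
        have h2 : ContinuousOn u (Set.Icc (t i) (t (i + 1))) := (hu.smooth i hi).continuousOn
        simp only [height]
        fun_prop
      obtain ⟨ξ, hξ, hξe⟩ := exists_hasDerivAt_eq_slope
        (fun x => height f (v x) - σ * height f (u x)) (fun _ => 0) (hsub.lt i hi) hvu
        fun x hx => by
          have hxI := Set.Ioo_subset_Icc_self hx
          have h1 := (hv.hasDerivWithinAt hi hxI).height f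
          have h2 := ((hu.smooth.hasDerivWithinAt hi hxI).height f).const_mul σ
          rw [hσ x hx, height_smul] at h1
          have h3 := (h1.sub h2).hasDerivAt (Icc_mem_nhds hx.1 hx.2)
          rw [sub_self] at h3
          exact h3
      rw [eq_comm, div_eq_zero_iff, or_iff_left (sub_pos.2 (hsub.lt i hi)).ne', hend i hi,
        hstart i hi] at hξe
      have hσ0 : σ * (height f (u (t (i + 1))) - height f (u (t i))) = 0 := by linarith
      have hσ0 := (mul_eq_zero.1 hσ0).resolve_right
        (sub_ne_zero.2 (hf.height_ne_of_straight hu hi hsi))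
      rw [hσ s hs, hσ0, zero_smul]
    · obtain ⟨σ, hσ⟩ := hpar i hi s hsI
      have h1 := (hv.hasDerivWithinAt hi hsI).height f
      have h2 : HasDerivWithinAt (fun x => height f (v x)) 0 (Set.Icc (t i) (t (i + 1))) s :=
        (hasDerivWithinAt_const s _ h).congr (hstrict i hi hci) (hstrict i hi hci s hsI)
      have h3 := (hsub.uniqueDiffOn hi s hsI).eq_deriv _ h1 h2
      rw [hσ, height_smul] at h3
      rw [hσ, (mul_eq_zero.1 h3).resolve_right fun hb => hsf (hf.eq_of_height_eq_zero hu hi hsI hb),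
        zero_smul]
  -- the points with `u s = ± f` are finitely many
  set E : Set ℝ := Set.range t ∪ ({s ∈ Set.Ico 0 (2 * T) | u s = f} ∪
    {s ∈ Set.Ico 0 (2 * T) | u s = -f}) with hE
  have hfib : ∀ x : ℝ × ℝ, {s ∈ Set.Ico 0 (2 * T) | u s = x}.Countable := fun x =>
    Set.Subsingleton.countable fun s hs s' hs' => hu.injOn hs.1 hs'.1 (hs.2.trans hs'.2.symm)
  have hEc : E.Countable := (Set.countable_range t).union ((hfib f).union (hfib (-f)))
  intro s hs
  have hcv := hv.continuousOn hsub
  have hint := integral_eq_of_hasDerivAt_off_countable_of_le v (fun _ => 0) hs.1 hEc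
    (hcv.mono (Set.Icc_subset_Icc_right hs.2)) (fun x hx => by
      have hx0 : x ∈ Set.Ico 0 (2 * T) := ⟨hx.1.1.le, hx.1.2.trans_le hs.2⟩
      obtain ⟨i, hi, hxi⟩ := hsub.exists_mem_Ioo hx0 fun hr => hx.2 (Or.inl hr)
      have := hv.hasDerivAt hi hxi
      rwa [hderiv i hi x hxi ?_] at this
      rintro (e | e)
      · exact hx.2 (Or.inr (Or.inl ⟨hx0, e⟩))
      · exact hx.2 (Or.inr (Or.inr ⟨hx0, e⟩))) intervalIntegrable_const
  rw [intervalIntegral.integral_zero] at hint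
  exact (sub_eq_zero.1 hint.symm)

end Equality

/-! ### The mixed area -/

section MixedArea

variable {n : ℕ} {T : ℝ} {t : ℕ → ℝ} {c d : ℝ → ℝ × ℝ}

lemma IsSubdivision.integral_congr (h : IsSubdivision n T t) {f g : ℝ → ℝ}
    (hfg : ∀ i < 2 * n, ∀ s ∈ Set.Ioo (t i) (t (i + 1)), f s = g s) :
    ∫ s in (0 : ℝ)..(2 * T), f s = ∫ s in (0 : ℝ)..(2 * T), g s := by
  refine intervalIntegral.integral_congr_ae_restrict ?_
  rw [Set.uIoc_of_le (by linarith [h.pos]), ← restrict_Ioo_eq_restrict_Ioc]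
  refine (ae_restrict_iff' measurableSet_Ioo).2 ?_
  filter_upwards [(Set.countable_range t).ae_notMem volume] with s hst hs
  obtain ⟨i, hi, hsi⟩ := h.exists_mem_Ioo (Set.Ioo_subset_Ico_self hs) hst
  exact hfg i hi s hsi

lemma SmoothByParts.deriv_eq (hc : SmoothByParts n t c) {i : ℕ} (hi : i < 2 * n) {s : ℝ}
    (hs : s ∈ Set.Ioo (t i) (t (i + 1))) : deriv c s = pieceDeriv t c i s :=
  (hc.hasDerivAt hi hs).deriv

lemma SmoothByParts.intervalIntegrable_det (h : IsSubdivision n T t) (hc : SmoothByParts n t c)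
    (hd : SmoothByParts n t d) :
    IntervalIntegrable (fun s => det (c s) (deriv d s)) volume 0 (2 * T) := by
  refine intervalIntegrable_of_pieces h (g := fun i s => det (c s) (pieceDeriv t d i s))
    (fun i hi => ?_) fun i hi s hs => ?_
  · have h1 : ContinuousOn c (Set.Icc (t i) (t (i + 1))) := (hc i hi).continuousOn
    have h2 := hd.continuousOn_pieceDeriv h hi
    simp only [det]
    fun_prop
  · simp only [hd.deriv_eq hi hs]

/-- The mixed area of closed curves is symmetric, by integration by parts. -/
lemma SmoothByParts.integral_det_comm (h : IsSubdivision n T t) (hc : SmoothByParts n t c)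
    (hd : SmoothByParts n t d) (hc0 : c 0 = c (2 * T)) (hd0 : d 0 = d (2 * T)) :
    ∫ s in (0 : ℝ)..(2 * T), det (c s) (deriv d s)
      = ∫ s in (0 : ℝ)..(2 * T), det (d s) (deriv c s) := by
  rw [← sub_eq_zero, ← intervalIntegral.integral_sub (hc.intervalIntegrable_det h hd)
    (hd.intervalIntegrable_det h hc)]
  have hcc := hc.continuousOn h
  have hdc := hd.continuousOn h
  refine (integral_eq_sub_of_pieces h (F := fun s => det (c s) (d s))
    (g := fun i s => det (c s) (pieceDeriv t d i s) - det (d s) (pieceDeriv t c i s))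
    (fun i hi => ?_) (fun i hi s hs => ?_) ?_ fun i hi s hs => ?_).trans ?_
  · have h1 : ContinuousOn c (Set.Icc (t i) (t (i + 1))) := (hc i hi).continuousOn
    have h2 : ContinuousOn d (Set.Icc (t i) (t (i + 1))) := (hd i hi).continuousOn
    have h3 := hc.continuousOn_pieceDeriv h hi
    have h4 := hd.continuousOn_pieceDeriv h hi
    simp only [det]
    fun_prop
  · simp only [hd.deriv_eq hi hs, hc.deriv_eq hi hs]
  · simp only [det]
    fun_prop
  · have k1 := hc.hasDerivAt hi hs
    have k2 := hd.hasDerivAt hi hs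
    have c1 := (hasFDerivAt_fst (𝕜 := ℝ) (p := c s)).comp_hasDerivAt s k1
    have c2 := (hasFDerivAt_snd (𝕜 := ℝ) (p := c s)).comp_hasDerivAt s k1
    have d1 := (hasFDerivAt_fst (𝕜 := ℝ) (p := d s)).comp_hasDerivAt s k2
    have d2 := (hasFDerivAt_snd (𝕜 := ℝ) (p := d s)).comp_hasDerivAt s k2
    have e := (c1.mul d2).sub (c2.mul d1)
    convert! e using 1
    simp only [det, Function.comp_apply, ContinuousLinearMap.coe_fst', ContinuousLinearMap.coe_snd']
    ring
  · simp only [hc0, hd0, sub_self]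

lemma SmoothByParts.deriv_sub_smul (hc : SmoothByParts n t c) (hd : SmoothByParts n t d) (k : ℝ)
    {i : ℕ} (hi : i < 2 * n) {s : ℝ} (hs : s ∈ Set.Ioo (t i) (t (i + 1))) :
    deriv (fun s => c s - k • d s) s = deriv c s - k • deriv d s := by
  rw [hc.deriv_eq hi hs, hd.deriv_eq hi hs]
  exact ((hc.hasDerivAt hi hs).sub ((hd.hasDerivAt hi hs).const_smul k)).deriv

/-- The area of `c - k d`, as a quadratic polynomial in `k`. -/
lemma SmoothByParts.integral_det_sub_smul (h : IsSubdivision n T t) (hc : SmoothByParts n t c)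
    (hd : SmoothByParts n t d) (hc0 : c 0 = c (2 * T)) (hd0 : d 0 = d (2 * T)) (k : ℝ) :
    ∫ s in (0 : ℝ)..(2 * T), det (c s - k • d s) (deriv (fun s => c s - k • d s) s)
      = (∫ s in (0 : ℝ)..(2 * T), det (c s) (deriv c s))
        - 2 * k * (∫ s in (0 : ℝ)..(2 * T), det (d s) (deriv c s))
        + k ^ 2 * ∫ s in (0 : ℝ)..(2 * T), det (d s) (deriv d s) := by
  have i1 := hc.intervalIntegrable_det h hc
  have i2 := (hc.intervalIntegrable_det h hd).const_mul k
  have i3 := (hd.intervalIntegrable_det h hc).const_mul k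
  have i4 := (hd.intervalIntegrable_det h hd).const_mul (k ^ 2)
  have e : ∫ s in (0 : ℝ)..(2 * T), det (c s - k • d s) (deriv (fun s => c s - k • d s) s)
      = ∫ s in (0 : ℝ)..(2 * T), (det (c s) (deriv c s) - k * det (c s) (deriv d s)
        - k * det (d s) (deriv c s) + k ^ 2 * det (d s) (deriv d s)) := by
    refine h.integral_congr fun i hi s hs => ?_
    rw [hc.deriv_sub_smul hd k hi hs]
    simp only [det, Prod.fst_sub, Prod.snd_sub, Prod.smul_fst, Prod.smul_snd, smul_eq_mul]
    ring
  rw [e, intervalIntegral.integral_add ((i1.sub i2).sub i3) i4,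
    intervalIntegral.integral_sub (i1.sub i2) i3, intervalIntegral.integral_sub i1 i2,
    intervalIntegral.integral_const_mul, intervalIntegral.integral_const_mul,
    intervalIntegral.integral_const_mul, hc.integral_det_comm h hd hc0 hd0]
  ring

/-- Up to the factor `|f|²`, twice the area of a closed curve is `-∫ 2 y x'`, where `y` is the
height along `f`, measured from any level `h`, and `x` the coordinate across. -/
lemma SmoothByParts.integral_det_self_mul (h : IsSubdivision n T t) (hc : SmoothByParts n t c)
    (hc0 : c 0 = c (2 * T)) (f : ℝ × ℝ) (l : ℝ) :
    (∫ s in (0 : ℝ)..(2 * T), det (c s) (deriv c s)) * height f f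
      = -∑ i ∈ Finset.range (2 * n), ∫ s in (t i)..(t (i + 1)),
          2 * (height f (c s) - l) * det (pieceDeriv t c i s) f := by
  have hcc := hc.continuousOn h
  have hg : ∀ i < 2 * n, ContinuousOn
      (fun s => 2 * (height f (c s) - l) * det (pieceDeriv t c i s) f)
      (Set.Icc (t i) (t (i + 1))) := by
    intro i hi
    have h1 : ContinuousOn c (Set.Icc (t i) (t (i + 1))) := (hc i hi).continuousOn
    have h3 := hc.continuousOn_pieceDeriv h hi
    simp only [det, height]
    fun_prop
  have hfg : ∀ i < 2 * n, Set.EqOn (fun s => 2 * (height f (c s) - l) * det (deriv c s) f)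
      (fun s => 2 * (height f (c s) - l) * det (pieceDeriv t c i s) f)
      (Set.Ioo (t i) (t (i + 1))) := by
    intro i hi s hs
    simp only [hc.deriv_eq hi hs]
  rw [← integral_eq_sum_pieces h (f := fun s => 2 * (height f (c s) - l) * det (deriv c s) f)
      (g := fun i s => 2 * (height f (c s) - l) * det (pieceDeriv t c i s) f) hg hfg,
    eq_neg_iff_add_eq_zero, ← intervalIntegral.integral_mul_const,
    ← intervalIntegral.integral_add ((hc.intervalIntegrable_det h hc).mul_const _)
      (intervalIntegrable_of_pieces h
        (g := fun i s => 2 * (height f (c s) - l) * det (pieceDeriv t c i s) f) hg hfg)]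
  refine (integral_eq_sub_of_pieces h (F := fun s => det (c s) f * (height f (c s) - 2 * l))
    (g := fun i s => det (c s) (pieceDeriv t c i s) * height f f
      + 2 * (height f (c s) - l) * det (pieceDeriv t c i s) f)
    (fun i hi => ?_) (fun i hi s hs => ?_) ?_ fun i hi s hs => ?_).trans ?_
  · have h1 : ContinuousOn c (Set.Icc (t i) (t (i + 1))) := (hc i hi).continuousOn
    have h3 := hc.continuousOn_pieceDeriv h hi
    simp only [det, height]
    fun_prop
  · simp only [hc.deriv_eq hi hs]
  · simp only [det, height]
    fun_prop
  · have hsI := Set.Ioo_subset_Icc_self hs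
    have h1 := (hc.hasDerivWithinAt hi hsI).det_const f
    have h2 := ((hc.hasDerivWithinAt hi hsI).height f).sub_const (2 * l)
    have e := (h1.mul h2).hasDerivAt (Icc_mem_nhds hs.1 hs.2)
    convert! e using 1
    rw [det_mul_height]
    ring
  · rw [hc0, sub_self]

end MixedArea

/-! ### Minkowski's inequality for admissible curves -/

section Minkowski

variable {N : Seminorm ℝ (ℝ × ℝ)} {n : ℕ} {T : ℝ} {t : ℕ → ℝ} {u γ : ℝ → ℝ × ℝ} {r : ℝ → ℝ}

lemma IsAdmissible.pieceDeriv_eq (hu : IsUnitCircle N n T t u) (hγ : IsAdmissible n T t u γ r)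
    (k : ℝ) {i : ℕ} (hi : i < 2 * n) {s : ℝ} (hs : s ∈ Set.Ioo (t i) (t (i + 1))) :
    pieceDeriv t (fun s => γ s - k • u s) i s = (r s - k) • pieceDeriv t u i s := by
  rw [← (hγ.smooth.const_smul_sub hu.smooth k).deriv_eq hi hs,
    hγ.smooth.deriv_sub_smul hu.smooth k hi hs, hγ.deriv_eq i hi s hs,
    hu.smooth.deriv_eq hi hs, sub_smul]

/-- The relation `γ' = r u'` extends to the ends of the pieces by continuity. -/
lemma IsAdmissible.isParallel (hu : IsUnitCircle N n T t u) (hγ : IsAdmissible n T t u γ r)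
    (k : ℝ) : IsParallel n t u fun s => γ s - k • u s := by
  intro i hi s hs
  have hsub := hu.subdivision
  have hcu := hu.smooth.continuousOn_pieceDeriv hsub hi
  have hcv := (hγ.smooth.const_smul_sub hu.smooth k).continuousOn_pieceDeriv hsub hi
  refine exists_smul_eq_of_det_eq_zero (hu.deriv_ne_zero i hi s hs) ?_
  have hcl : closure (Set.Ioo (t i) (t (i + 1))) = Set.Icc (t i) (t (i + 1)) :=
    closure_Ioo (hsub.lt i hi).ne
  have hc : ContinuousOn (fun s => det (pieceDeriv t u i s)
      (pieceDeriv t (fun s => γ s - k • u s) i s)) (Set.Icc (t i) (t (i + 1))) := by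
    simp only [det]
    fun_prop
  have h0 : ∀ x ∈ Set.Ioo (t i) (t (i + 1)), det (pieceDeriv t u i x)
      (pieceDeriv t (fun s => γ s - k • u s) i x) = 0 := by
    intro x hx
    rw [hγ.pieceDeriv_eq hu k hi hx]
    simp only [det, Prod.smul_fst, Prod.smul_snd, smul_eq_mul]
    ring
  rw [← hcl] at hs hc
  exact le_antisymm (le_on_closure (fun x hx => (h0 x hx).le) hc continuousOn_const hs)
    (le_on_closure (fun x hx => (h0 x hx).ge) continuousOn_const hc hs)

/-- Some curve `γ - k u` has area at most zero, namely for the ratio `k` of the widths of `γ` and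
`u` in an extremal direction. If its area is zero, `γ` is homothetic to `u`. -/
lemma IsAdmissible.exists_integral_nonpos (hu : IsUnitCircle N n T t u)
    (hγ : IsAdmissible n T t u γ r) :
    ∃ k : ℝ, ∫ s in (0 : ℝ)..(2 * T), det (γ s - k • u s) (deriv (fun s => γ s - k • u s) s) ≤ 0 ∧
      (∫ s in (0 : ℝ)..(2 * T), det (γ s - k • u s) (deriv (fun s => γ s - k • u s) s) = 0 →
        ∃ p : ℝ × ℝ, ∀ s ∈ Set.Icc 0 (2 * T), γ s = k • u s + p) := by
  have hsub := hu.subdivision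
  obtain ⟨f, hf⟩ := hu.exists_isHeightExtremal
  have hD := height_self_pos hf.ne_zero
  obtain ⟨s₀, hs₀, e₀⟩ := hu.exists_eq hf.seminorm_eq_one
  obtain ⟨s₁, hs₁, e₁⟩ := hu.exists_eq (x := -f) (by rw [map_neg_eq_map, hf.seminorm_eq_one])
  have hf2 : height f (-f) = -height f f := height_neg_self f
  -- with this `k`, the curve `γ - k u` has the same height `h` at the two extremal parameters
  set k : ℝ := (height f (γ s₀) - height f (γ s₁)) / (2 * height f f) with hk
  have hk' : k * height f f = (height f (γ s₀) - height f (γ s₁)) / 2 := by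
    rw [hk]
    field_simp
  set h : ℝ := (height f (γ s₀) + height f (γ s₁)) / 2 with hh
  have hγu : ∀ s ∈ Set.Icc 0 (2 * T), ∀ s' ∈ Set.Icc 0 (2 * T), u s = u s' → γ s = γ s' := by
    intro s hs s' hs' e
    rcases hu.eq_or_ends hs hs' e with rfl | ⟨rfl, rfl⟩ | ⟨rfl, rfl⟩
    · rfl
    · exact hγ.closed
    · exact hγ.closed.symm
  have h0 : ∀ s ∈ Set.Icc 0 (2 * T), (u s = f ∨ u s = -f) → height f (γ s - k • u s) = h := by
    rintro s hs (e | e)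
    · rw [height_sub, height_smul, hγu s hs s₀ hs₀ (e.trans e₀.symm), e, hk', hh]
      ring
    · rw [height_sub, height_smul, hγu s hs s₁ hs₁ (e.trans e₁.symm), e, hf2, mul_neg, hk', hh]
      ring
  have hv := hγ.smooth.const_smul_sub hu.smooth k
  have hclosed : γ 0 - k • u 0 = γ (2 * T) - k • u (2 * T) := by rw [hγ.closed, hu.closed]
  have hpar := hγ.isParallel hu k
  have harea := hv.integral_det_self_mul hsub hclosed f h
  have hnonneg := (hf.sum_integral_nonneg hu hv hpar hclosed h0).1
  refine ⟨k, ?_, fun hzero => ?_⟩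
  · by_contra hpos
    have := mul_pos (not_le.1 hpos) hD
    rw [harea] at this
    linarith
  · rw [hzero, zero_mul, eq_comm, neg_eq_zero] at harea
    have hconst := hf.eq_of_sum_integral_eq_zero hu hv hpar hclosed (fun i hi hst => by
      obtain ⟨ρ, hρ⟩ := hγ.ratio i hi hst
      exact ⟨ρ - k, fun s hs => by rw [hγ.pieceDeriv_eq hu k hi hs, hρ s hs]⟩) h0 harea
    exact ⟨γ 0 - k • u 0, fun s hs => by rw [← hconst s hs]; abel⟩

lemma IsAdmissible.dualLength_eq (hu : IsUnitCircle N n T t u) (hγ : IsAdmissible n T t u γ r) :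
    dualLength T u r = ∫ s in (0 : ℝ)..(2 * T), det (u s) (deriv γ s) := by
  refine hu.subdivision.integral_congr fun i hi s hs => ?_
  rw [hγ.deriv_eq i hi s hs]
  simp only [det, Prod.smul_fst, Prod.smul_snd, smul_eq_mul]
  ring

lemma IsUnitCircle.ballArea_pos (hN : ∀ x, N x = 0 → x = 0) (hu : IsUnitCircle N n T t u) :
    0 < ballArea N := by
  have hsub := hu.subdivision
  have h2 := hu.two_mul_ballArea hN
  have hg : ∀ i < 2 * n, ContinuousOn (fun s => det (u s) (pieceDeriv t u i s))
      (Set.Icc (t i) (t (i + 1))) := by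
    intro i hi
    have h1 : ContinuousOn u (Set.Icc (t i) (t (i + 1))) := (hu.smooth i hi).continuousOn
    have h3 := hu.smooth.continuousOn_pieceDeriv hsub hi
    simp only [det]
    fun_prop
  rw [integral_eq_sum_pieces hsub (g := fun i s => det (u s) (pieceDeriv t u i s)) hg
    fun i hi s hs => by simp only [hu.smooth.deriv_eq hi hs]] at h2
  have hpos : 0 < ∑ i ∈ Finset.range (2 * n),
      ∫ s in (t i)..(t (i + 1)), det (u s) (pieceDeriv t u i s) := by
    refine Finset.sum_pos (fun i hi => ?_) ⟨0, Finset.mem_range.2 (by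
      have := hsub.n_pos
      omega)⟩
    have hi := Finset.mem_range.1 hi
    exact intervalIntegral.intervalIntegral_pos_of_pos_on
      ((hg i hi).intervalIntegrable_of_Icc (hsub.lt i hi).le)
      (fun s hs => hu.det_pos hi (Set.Ioo_subset_Icc_self hs)) (hsub.lt i hi)
  linarith

/-- If `γ` is a translate of `k u`, its dual length is `2 k A_U`, and `γ - k u` has no area. -/
lemma IsAdmissible.eq_of_homothetic (hN : ∀ x, N x = 0 → x = 0) (hu : IsUnitCircle N n T t u)
    (hγ : IsAdmissible n T t u γ r) {k : ℝ} {p : ℝ × ℝ}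
    (h : ∀ s ∈ Set.Icc 0 (2 * T), γ s = k • u s + p) :
    dualLength T u r = 2 * k * ballArea N ∧
      ∫ s in (0 : ℝ)..(2 * T), det (γ s - k • u s) (deriv (fun s => γ s - k • u s) s) = 0 := by
  have hsub := hu.subdivision
  have hder : ∀ i < 2 * n, ∀ s ∈ Set.Ioo (t i) (t (i + 1)),
      deriv (fun s => γ s - k • u s) s = 0 := by
    intro i hi s hs
    have hev : (fun s => γ s - k • u s) =ᶠ[nhds s] fun _ => p := by
      filter_upwards [Ioo_mem_nhds hs.1 hs.2] with x hx
      rw [h x (hsub.Icc_subset hi (Set.Ioo_subset_Icc_self hx)), add_sub_cancel_left]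
    rw [hev.deriv_eq, deriv_const]
  constructor
  · have e : ∫ s in (0 : ℝ)..(2 * T), det (u s) (deriv γ s)
        = ∫ s in (0 : ℝ)..(2 * T), k * det (u s) (deriv u s) := by
      refine hsub.integral_congr fun i hi s hs => ?_
      have := hder i hi s hs
      rw [hγ.smooth.deriv_sub_smul hu.smooth k hi hs, sub_eq_zero] at this
      rw [this]
      simp only [det, Prod.smul_fst, Prod.smul_snd, smul_eq_mul]
      ring
    rw [hγ.dualLength_eq hu, e, intervalIntegral.integral_const_mul, ← hu.two_mul_ballArea hN]
    ring
  · rw [hsub.integral_congr (g := fun _ => 0) fun i hi s hs => ?_, intervalIntegral.integral_zero]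
    rw [hder i hi s hs]
    simp [det]

end Minkowski

end NormedPlane

theorem mainTheorem3 (N : Seminorm ℝ (ℝ × ℝ)) (hN : ∀ x, N x = 0 → x = 0)
    (n : ℕ) (T : ℝ) (t : ℕ → ℝ) (u : ℝ → ℝ × ℝ) (hu : NormedPlane.IsUnitCircle N n T t u)
    (γ : ℝ → ℝ × ℝ) (r : ℝ → ℝ) (hγ : NormedPlane.IsAdmissible n T t u γ r)
    (hconv : NormedPlane.IsConvexCurve T γ) :
    NormedPlane.dualLength T u r ^ 2 / (4 * NormedPlane.ballArea N) ≥
        NormedPlane.signedArea T γ ∧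
      (NormedPlane.dualLength T u r ^ 2 / (4 * NormedPlane.ballArea N) =
          NormedPlane.signedArea T γ ↔
        ∃ (c : ℝ) (p : ℝ × ℝ), ∀ s ∈ Set.Icc 0 (2 * T), γ s = c • u s + p) := by
  have hA := hu.ballArea_pos hN
  -- twice the area of `γ - k u` is `2 A_γ - 2 k L + 2 k² A_U`
  have hquad : ∀ k : ℝ, ∫ s in (0 : ℝ)..(2 * T), NormedPlane.det (γ s - k • u s)
      (deriv (fun s => γ s - k • u s) s) = 2 * NormedPlane.signedArea T γ
        - 2 * k * NormedPlane.dualLength T u r + k ^ 2 * (2 * NormedPlane.ballArea N) := by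
    intro k
    rw [hγ.smooth.integral_det_sub_smul hu.subdivision hu.smooth hγ.closed hu.closed,
      hγ.dualLength_eq hu, hu.two_mul_ballArea hN, NormedPlane.signedArea, NormedPlane.mixedArea]
    ring
  set A := NormedPlane.ballArea N
  set L := NormedPlane.dualLength T u r
  set S := NormedPlane.signedArea T γ
  obtain ⟨k, hk, hk0⟩ := hγ.exists_integral_nonpos hu
  rw [hquad] at hk hk0
  refine ⟨?_, fun heq => ?_, fun ⟨c, p, hcp⟩ => ?_⟩
  · rw [ge_iff_le, le_div_iff₀ (by positivity)]
    nlinarith [sq_nonneg (L - 2 * k * A)]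
  · rw [div_eq_iff (by positivity)] at heq
    have hsq : 2 * A * (2 * S - 2 * k * L + k ^ 2 * (2 * A)) = (L - 2 * k * A) ^ 2 := by
      linear_combination -heq
    refine ⟨k, hk0 (le_antisymm hk ?_)⟩
    by_contra hneg
    nlinarith [sq_nonneg (L - 2 * k * A), mul_neg_of_pos_of_neg hA (not_le.1 hneg)]
  · obtain ⟨hL, hS⟩ := hγ.eq_of_homothetic hN hu hcp
    change L = 2 * c * A at hL
    rw [hquad, hL] at hS
    rw [hL, div_eq_iff (by positivity)]
    linear_combination (-2 * A) * hS
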